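/- Let $M_d$ be the space of complex $d\times d$ matrices, with its usual topology and the Hilbert–Schmidt inner product $(A,B)\mapsto \mathrm{Tr}(B^*A)$. An operator system (non-commutative graph) in $M_d$ is a linear subspace $\mathcal S\subseteq M_d$ such that $I\in\mathcal S$ and $A^*\in\mathcal S$ whenever $A\in\mathcal S$. A quantum channel $\Phi:M_d\to M_k$ is a completely positive trace preserving linear map. If $\Phi(T)=\sum_{p=1}^m A_pTA_p^*$ is a Kraus representation of $\Phi$, let $\mathcal S_\Phi=\mathrm{span}\{A_p^*A_q: p,q=1,\dots,m\}$ (this does not depend on the representation). For an operator system $\mathcal S\subseteq M_d$ and $k\in\mathbb N$, let $\mathfrak C_k(\mathcal S)$ be the set of quantum channels $\Phi:M_d\to M_k$ with $\mathcal S_\Phi\subseteq\mathcal S$, and set $$\mathrm{th}_k(\mathcal S)=\{T\in M_d^+:\ \Phi(T)\le I \text{ for all }\Phi\in\mathfrak C_k(\mathcal S)\},\qquad \mathrm{th}(\mathcal S)=\bigcap_{k\in\mathbb N}\mathrm{th}_k(\mathcal S),$$ $$\theta_k(\mathcal S)=\sup\{\mathrm{Tr}(T):T\in\mathrm{th}_k(\mathcal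 S)\},\qquad \theta(\mathcal S)=\sup\{\mathrm{Tr}(T):T\in\mathrm{th}(\mathcal S)\}.$$ Let $\mathcal E_k$ be the set of extreme points of the convex set of all quantum channels $M_d\to M_k$. For a sequence $(F_n)$ of subsets of a topological space, let $\liminf F_n$ be the set of limits of convergent sequences $(x_n)$ with $x_n\in F_n$ for all $n$, let $\limsup F_n$ be the set of cluster points of sequences $(x_n)$ with $x_n\in F_n$ for all $n$, and write $F=\lim F_n$ (Kuratowski convergence) if $F=\liminf F_n=\limsup F_n$. **Theorem.** (1) For every operator system $\mathcal S\subseteq M_d$ and every $k\ge d^2$, $$\mathrm{th}_{d^2}(\mathcal S)=\mathrm{th}_k(\mathcal S)=\{T\in M_d^+:\ \Psi(T)\le I\text{ for all }\Psi\in\mathfrak C_k(\mathcal S)\cap\mathcal E_k\}.$$ Moreover $\mathrm{th}(\mathcal S)=\mathrm{th}_{d^2}(\mathcal S)$ and $\theta(\mathcal S)=\theta_{d^2}(\mathcal S)$. (2) If $\mathcal S$ and $\mathcal S_n$, $n\in\mathbb N$, are operator systems in $M_d$ with $\mathcal S=\lim_{n\to\infty}\mathcal S_n$, then $\mathrm{th}(\mathcal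 S)=\lim_{n\to\infty}\mathrm{th}(\mathcal S_n)$ and $\theta(\mathcal S_n)\to\theta(\mathcal S)$. (3) Let $M_d^0$ be the set of non-zero hermitian matrices of trace zero in $M_d$, and for $\Lambda\in M_d^0$ let $\{\Lambda\}^\perp$ be the orthogonal complement of $\Lambda$ in $M_d$ (an operator system). The function $\Lambda\mapsto\theta(\{\Lambda\}^\perp)$ is continuous on $M_d^0$. If $d\ge 2$, its range is a closed interval $[\delta_1,\delta_2]$ with $1<\delta_1\le\delta_2\le d$; if $d\ge 3$, then moreover $\delta_1<\delta_2$. -/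

import Mathlib

open Filter Topology
open scoped ComplexOrder

namespace NCGraph

/-- `M_d`, the complex `d × d` matrices (with the usual topology). -/
abbrev Mat (d : ℕ) : Type := Matrix (Fin d) (Fin d) ℂ

/-- Linear maps `M_d → M_k`. -/
abbrev SuperOp (d k : ℕ) : Type := Mat d →ₗ[ℂ] Mat k

/-- An operator system in `M_d` (a non-commutative graph): a subspace which contains the identity
and is closed under adjoints. -/
def IsOperatorSystem {d : ℕ} (S : Submodule ℂ (Mat d)) : Prop :=
  (1 : Mat d) ∈ S ∧ ∀ A ∈ S, A.conjTranspose ∈ S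

/-- The amplification `Φ^(m)`, applying `Φ` to each of the `m²` blocks (of size `d × d`)
of a matrix in `M_m(M_d)`. -/
def amplify {d k : ℕ} (Φ : SuperOp d k) (m : ℕ) (X : Matrix (Fin m × Fin d) (Fin m × Fin d) ℂ) :
    Matrix (Fin m × Fin k) (Fin m × Fin k) ℂ :=
  Matrix.of fun p q => Φ (Matrix.of fun a b => X (p.1, a) (q.1, b)) p.2 q.2

/-- `Φ` is completely positive: every amplification preserves positivity. -/
def IsCompletelyPositive {d k : ℕ} (Φ : SuperOp d k) : Prop :=
  ∀ (m : ℕ) (X : Matrix (Fin m × Fin d) (Fin m × Fin d) ℂ),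
    X.PosSemidef → (amplify Φ m X).PosSemidef

/-- A quantum channel: a completely positive, trace preserving linear map. -/
def IsQuantumChannel {d k : ℕ} (Φ : SuperOp d k) : Prop :=
  IsCompletelyPositive Φ ∧ ∀ T : Mat d, (Φ T).trace = T.trace

/-- `A₁, …, A_m` are Kraus operators of `Φ`: `Φ(T) = ∑ A_p T A_p*`. -/
def IsKraus {d k m : ℕ} (Φ : SuperOp d k) (A : Fin m → Matrix (Fin k) (Fin d) ℂ) : Prop :=
  ∀ T : Mat d, Φ T = ∑ p, A p * T * (A p).conjTranspose

/-- The non-commutative graph `S_Φ` of `Φ`: the span of the products `A_p* A_q` of Kraus operators.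
The supremum runs over all Kraus representations; for completely positive `Φ` there is one, and
all of them give the same span (`exists_isKraus` and `channelGraph_eq` below). -/
def channelGraph {d k : ℕ} (Φ : SuperOp d k) : Submodule ℂ (Mat d) :=
  ⨆ (m : ℕ) (A : Fin m → Matrix (Fin k) (Fin d) ℂ) (_ : IsKraus Φ A),
    Submodule.span ℂ (Set.range fun p : Fin m × Fin m => (A p.1).conjTranspose * A p.2)

/-- `C_k(S)`: the quantum channels `Φ : M_d → M_k` with `S_Φ ⊆ S`. -/
def channelsInto {d : ℕ} (S : Submodule ℂ (Mat d)) (k : ℕ) : Set (SuperOp d k) :=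
  {Φ | IsQuantumChannel Φ ∧ channelGraph Φ ≤ S}

/-- `th_k(S)`: the positive `T` with `Φ(T) ≤ I` for all `Φ ∈ C_k(S)`. -/
def thCornerAt {d : ℕ} (S : Submodule ℂ (Mat d)) (k : ℕ) : Set (Mat d) :=
  {T | T.PosSemidef ∧ ∀ Φ ∈ channelsInto S k, (1 - Φ T).PosSemidef}

/-- `th(S)`: the positive `T` with `Φ(T) ≤ I` for all `Φ ∈ C_k(S)` and all `k`. -/
def thCorner {d : ℕ} (S : Submodule ℂ (Mat d)) : Set (Mat d) :=
  {T | T.PosSemidef ∧ ∀ (k : ℕ), ∀ Φ ∈ channelsInto S k, (1 - Φ T).PosSemidef}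

/-- `θ(𝒜) = sup {Tr A : A ∈ 𝒜}`, for a bounded set `𝒜` of positive matrices. -/
noncomputable def supTrace {d : ℕ} (𝒜 : Set (Mat d)) : ℝ :=
  sSup ((fun T : Mat d => T.trace.re) '' 𝒜)

/-- The Lovász number `θ(S) = θ(th(S))`. -/
noncomputable def lovaszTheta {d : ℕ} (S : Submodule ℂ (Mat d)) : ℝ :=
  supTrace (thCorner S)

/-- `θ_k(S) = θ(th_k(S))`. -/
noncomputable def lovaszThetaAt {d : ℕ} (S : Submodule ℂ (Mat d)) (k : ℕ) : ℝ :=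
  supTrace (thCornerAt S k)

/-- `E_k`: the extreme points of the convex set of all quantum channels `M_d → M_k`. -/
def extremeChannels (d k : ℕ) : Set (SuperOp d k) :=
  Set.extremePoints ℝ {Φ : SuperOp d k | IsQuantumChannel Φ}

/-- Lower limit of a sequence of sets: the limits of convergent selections. -/
def setLiminf {X : Type*} [TopologicalSpace X] (F : ℕ → Set X) : Set X :=
  {x | ∃ u : ℕ → X, (∀ n, u n ∈ F n) ∧ Tendsto u atTop (𝓝 x)}

/-- Upper limit of a sequence of sets: the cluster points of selections. -/
def setLimsup {X : Type*} [TopologicalSpace X] (F : ℕ → Set X) : Set X :=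
  {x | ∃ u : ℕ → X, (∀ n, u n ∈ F n) ∧ MapClusterPt x atTop u}

/-- Kuratowski convergence `F = lim F_n`. -/
def KuratowskiTendsto {X : Type*} [TopologicalSpace X] (F : ℕ → Set X) (L : Set X) : Prop :=
  L = setLiminf F ∧ L = setLimsup F

/-- The orthogonal complement of a set of matrices for the Hilbert–Schmidt inner product
`(A, B) ↦ Tr(B* A)`. -/
def hsOrthogonal {d : ℕ} (F : Set (Mat d)) : Submodule ℂ (Mat d) where
  carrier := {A | ∀ B ∈ F, (B.conjTranspose * A).trace = 0}
  add_mem' := by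
    intro A A' hA hA' B hB
    rw [Matrix.mul_add, Matrix.trace_add, hA B hB, hA' B hB, add_zero]
  zero_mem' := by
    intro B _
    simp
  smul_mem' := by
    intro c A hA B hB
    rw [Matrix.mul_smul, Matrix.trace_smul, hA B hB, smul_zero]

/-- `M_d^0`: the non-zero hermitian matrices of trace zero. -/
def tracelessHermitian (d : ℕ) : Set (Mat d) :=
  {Λ | Λ.IsHermitian ∧ Λ.trace = 0 ∧ Λ ≠ 0}

/-- `{Λ}^⊥` is an operator system for hermitian `Λ` of trace zero. -/
theorem isOperatorSystem_hsOrthogonal {d : ℕ} {Λ : Mat d} (h : Λ ∈ tracelessHermitian d) :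
    IsOperatorSystem (hsOrthogonal {Λ}) := by
  obtain ⟨hH, ht, -⟩ := h
  constructor
  · intro B hB
    rw [Set.mem_singleton_iff.1 hB, hH.eq, Matrix.mul_one, ht]
  · intro A hA B hB
    have h1 := hA B hB
    rw [Set.mem_singleton_iff.1 hB, hH.eq] at h1 ⊢
    have h2 : (Λ * A).conjTranspose.trace = 0 := by
      rw [Matrix.trace_conjTranspose, h1, star_zero]
    rwa [Matrix.conjTranspose_mul, hH.eq, Matrix.trace_mul_comm] at h2

/-- A completely positive map has a Kraus representation. -/
theorem exists_isKraus {d k : ℕ} {Φ : SuperOp d k} (h : IsCompletelyPositive Φ) :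
    ∃ (m : ℕ) (A : Fin m → Matrix (Fin k) (Fin d) ℂ), IsKraus Φ A := by
  have hJ := h d _ (Matrix.posSemidef_vecMulVec_self_star
    (fun p : Fin d × Fin d => if p.1 = p.2 then (1 : ℂ) else 0))
  obtain ⟨m, v, hv⟩ := Matrix.posSemidef_iff_eq_sum_vecMulVec.1 hJ
  refine ⟨m, fun p => Matrix.of fun a i => v p (i, a), ?_⟩
  let L : SuperOp d k :=
    { toFun := fun T => ∑ p, (Matrix.of fun a i => v p (i, a) : Matrix (Fin k) (Fin d) ℂ) * T *
        (Matrix.of fun a i => v p (i, a) : Matrix (Fin k) (Fin d) ℂ).conjTranspose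
      map_add' := fun X Y => by
        simp only [Matrix.mul_add, Matrix.add_mul, Finset.sum_add_distrib]
      map_smul' := fun c X => by
        simp only [Matrix.mul_smul, Matrix.smul_mul, Finset.smul_sum, RingHom.id_apply] }
  suffices hL : Φ = L from fun T => LinearMap.congr_fun hL T
  refine Matrix.ext_linearMap _ fun i j => LinearMap.ext_ring ?_
  ext a b
  have h2 := congrFun (congrFun hv (i, a)) (j, b)
  have h3 : (Matrix.of fun a b => Matrix.vecMulVec
      (fun p : Fin d × Fin d => if p.1 = p.2 then (1 : ℂ) else 0)
      (star fun p : Fin d × Fin d => if p.1 = p.2 then (1 : ℂ) else 0) (i, a) (j, b))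
      = Matrix.single i j 1 := by
    ext a b
    simp [Matrix.vecMulVec, Matrix.single, apply_ite]
    grind
  simp only [amplify, Matrix.of_apply] at h2
  rw [h3] at h2
  change Φ (Matrix.single i j 1) a b = (∑ p,
    (Matrix.of fun a i => v p (i, a) : Matrix (Fin k) (Fin d) ℂ) * Matrix.single i j (1 : ℂ) *
      (Matrix.of fun a i => v p (i, a) : Matrix (Fin k) (Fin d) ℂ).conjTranspose) a b
  rw [h2, Matrix.sum_apply, Matrix.sum_apply]
  refine Finset.sum_congr rfl fun p _ => ?_
  simp [Matrix.vecMulVec, Matrix.mul_apply, Matrix.single, ite_and]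

/-- All Kraus representations of a map give the same span of products, namely `S_Φ`. -/
theorem channelGraph_eq {d k m : ℕ} {Φ : SuperOp d k} {A : Fin m → Matrix (Fin k) (Fin d) ℂ}
    (hA : IsKraus Φ A) :
    channelGraph Φ =
      Submodule.span ℂ (Set.range fun p : Fin m × Fin m => (A p.1).conjTranspose * A p.2) := by
  refine le_antisymm (iSup_le fun l => iSup_le fun B => iSup_le fun hB => ?_)
    (le_iSup_of_le m (le_iSup_of_le A (le_iSup_of_le hA le_rfl)))
  have key : ∀ q, B q ∈ Submodule.span ℂ (Set.range A) := by
    intro q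
    by_contra hq
    obtain ⟨f, hf, hker⟩ := Submodule.exists_le_ker_of_notMem hq
    have hexp : ∀ X : Matrix (Fin k) (Fin d) ℂ,
        f X = ∑ x : Fin k × Fin d, X x.1 x.2 * f (Matrix.single x.1 x.2 1) := by
      intro X
      conv_lhs => rw [Matrix.matrix_eq_sum_single X]
      simp only [map_sum, Fintype.sum_prod_type]
      refine Finset.sum_congr rfl fun a _ => Finset.sum_congr rfl fun i _ => ?_
      have h4 : Matrix.single a i (X a i) = X a i • Matrix.single a i (1 : ℂ) := by simp
      rw [h4, map_smul, smul_eq_mul]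
    have hsum : ∀ (n : ℕ) (C : Fin n → Matrix (Fin k) (Fin d) ℂ), IsKraus Φ C →
        ∑ p, f (C p) * star (f (C p)) =
          ∑ x : Fin k × Fin d, ∑ y : Fin k × Fin d, Φ (Matrix.single x.2 y.2 1) x.1 y.1 *
            (f (Matrix.single x.1 x.2 1) * star (f (Matrix.single y.1 y.2 1))) := by
      intro n C hC
      have h5 : ∀ i j a b, Φ (Matrix.single i j 1) a b = ∑ p, C p a i * star (C p b j) := by
        intro i j a b
        rw [hC, Matrix.sum_apply]
        refine Finset.sum_congr rfl fun p _ => ?_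
        simp [Matrix.mul_apply, Matrix.single, ite_and]
      have h6 : ∀ p, f (C p) * star (f (C p)) = ∑ x : Fin k × Fin d, ∑ y : Fin k × Fin d,
          C p x.1 x.2 * star (C p y.1 y.2) *
            (f (Matrix.single x.1 x.2 1) * star (f (Matrix.single y.1 y.2 1))) := by
        intro p
        rw [hexp (C p), star_sum, Finset.sum_mul_sum]
        refine Finset.sum_congr rfl fun x _ => Finset.sum_congr rfl fun y _ => ?_
        rw [star_mul']
        ring
      simp only [h6, h5, Finset.sum_mul]
      rw [Finset.sum_comm]
      refine Finset.sum_congr rfl fun x _ => ?_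
      rw [Finset.sum_comm]
    have h0 : ∑ p, f (B p) * star (f (B p)) = 0 := by
      rw [hsum l B hB, ← hsum m A hA]
      refine Finset.sum_eq_zero fun p _ => ?_
      have : f (A p) = 0 := hker (Submodule.subset_span ⟨p, rfl⟩)
      rw [this, zero_mul]
    have h1 := (Finset.sum_eq_zero_iff_of_nonneg fun p _ => mul_star_self_nonneg (f (B p))).1 h0 q
      (Finset.mem_univ q)
    exact hf (by simpa using h1)
  rw [Submodule.span_le]
  rintro _ ⟨⟨p, q⟩, rfl⟩
  have step : ∀ X ∈ Submodule.span ℂ (Set.range A), ∀ Y ∈ Submodule.span ℂ (Set.range A),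
      X.conjTranspose * Y ∈ Submodule.span ℂ
        (Set.range fun p : Fin m × Fin m => (A p.1).conjTranspose * A p.2) := by
    intro X hX Y hY
    induction hX, hY using Submodule.span_induction₂ with
    | mem_mem x y hx hy =>
      obtain ⟨i, rfl⟩ := hx
      obtain ⟨j, rfl⟩ := hy
      exact Submodule.subset_span ⟨(i, j), rfl⟩
    | zero_left y hy => simp
    | zero_right x hx => simp
    | add_left x y z _ _ _ h1 h2 =>
      rw [Matrix.conjTranspose_add, Matrix.add_mul]
      exact Submodule.add_mem _ h1 h2
    | add_right x y z _ _ _ h1 h2 =>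
      rw [Matrix.mul_add]
      exact Submodule.add_mem _ h1 h2
    | smul_left r x y _ _ h1 =>
      rw [Matrix.conjTranspose_smul, Matrix.smul_mul]
      exact Submodule.smul_mem _ _ h1
    | smul_right r x y _ _ h1 =>
      rw [Matrix.mul_smul]
      exact Submodule.smul_mem _ _ h1
  exact step _ (key p) _ (key q)

end NCGraph

open NCGraph

namespace NCGraph

open Matrix

/-! ### Quadratic forms and positive matrices -/

section Quadratic

variable {n : Type*} [Fintype n]

/-! The bridge is a dictionary between channels and block matrices. Stack Kraus operators `A p` into
one row `R = [A_1 … A_m]`; then `X = Rᴴ * R` is positive, its blocks `(A p)ᴴ * A q` lie in `S`, and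
trace preservation says that its diagonal blocks sum to the identity. Testing `Φ(T) ≤ I` on `v` in
the unit ball only involves `a = Rᴴ v`, and the vectors obtained this way are exactly those with `a
a* ≤ X`. So `th(S)` is a polar: the positive `T` of weight `∑ ⟨a_p, T a_p⟩ ≤ 1` on all dominated
vectors of feasible `X`.

The dimension bound holds because the weight sees only the Gram matrix of the blocks `a_p ∈ ℂ^d`,
which span at most `d` directions in the block index. Compressing that index to `d` dimensions
preserves the weight, and `d` blocks of size `d` need only `d²` output dimensions
(`weightPolar_subset`, `thCornerAt_eq_weightPolar`). Extreme channels suffice by Krein–Milman on the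
compact face of channels whose Choi matrix vanishes on the kernel of that of `Φ`: their Kraus
operators lie in the span of those of `Φ`, so their graphs stay in `S`
(`thCornerAt_eq_extremeChannels`).

For continuity, all feasible pairs `(X, a)` with `d` blocks lie in one compact set. Cluster points
of pairs for `S_n` are pairs for `S`, so `T ∈ th(S)` lies in `th(S_n)` after scaling by a factor
tending to 1. Conversely a pair for `S`, shrunk slightly and mixed with the identity, is positive
with room to spare, so it can be perturbed to a pair for `S_n` (`eventually_exists_feasible`).

In the last part, the traceless hermitian matrices form a real space of dimension above one, so
removing zero leaves a connected set; scaling invariance reduces to a compact sphere, and the range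
is a closed interval. Its lower end exceeds 1 because the weight of the identity reaches `d` only if
`X = a a*`, which forces `S = ⊤` (`one_lt_lovaszTheta`). For `d ≥ 3` two diagonal matrices give
different values: at least 2 and at most 9/5 (`two_le_lovaszTheta`, `lovaszTheta_le_nine_fifths`).
-/

theorem star_dotProduct_self_re (v : n → ℂ) : (star v ⬝ᵥ v).re = ∑ i, ‖v i‖ ^ 2 := by
  simp only [dotProduct, Complex.re_sum, Pi.star_apply, RCLike.star_def, Complex.conj_mul']
  norm_cast

theorem star_dotProduct_self (v : n → ℂ) : star v ⬝ᵥ v = ((∑ i, ‖v i‖ ^ 2 : ℝ) : ℂ) := by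
  simp only [dotProduct, Pi.star_apply, RCLike.star_def, Complex.conj_mul']
  norm_cast

/-- Cauchy–Schwarz. -/
theorem norm_star_dotProduct_sq_le (v w : n → ℂ) :
    ‖star v ⬝ᵥ w‖ ^ 2 ≤ (∑ i, ‖v i‖ ^ 2) * ∑ i, ‖w i‖ ^ 2 := by
  have h := norm_inner_le_norm (𝕜 := ℂ) (WithLp.toLp 2 v : EuclideanSpace ℂ n) (WithLp.toLp 2 w)
  rw [EuclideanSpace.inner_eq_star_dotProduct, EuclideanSpace.norm_eq, EuclideanSpace.norm_eq,
    ← Real.sqrt_mul (by positivity)] at h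
  have h2 := Real.le_sqrt (by positivity) (by positivity) |>.1 h
  rwa [dotProduct_comm] at h2

theorem star_dotProduct_vecMulVec (a x : n → ℂ) :
    star x ⬝ᵥ (vecMulVec a (star a) *ᵥ x) = ((‖star a ⬝ᵥ x‖ ^ 2 : ℝ) : ℂ) := by
  rw [vecMulVec_mulVec, op_smul_eq_smul, dotProduct_smul, smul_eq_mul, star_dotProduct x a, RCLike.star_def, Complex.mul_conj']
  norm_cast

theorem isHermitian_vecMulVec (a : n → ℂ) : (vecMulVec a (star a)).IsHermitian :=
  (posSemidef_vecMulVec_self_star a).1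

theorem PosSemidef.im_zero {M : Matrix n n ℂ} (hM : M.PosSemidef) (v : n → ℂ) :
    (star v ⬝ᵥ (M *ᵥ v)).im = 0 :=
  ((Complex.le_def.1 (hM.dotProduct_mulVec_nonneg v)).2).symm

theorem posSemidef_iff_re {M : Matrix n n ℂ} :
    M.PosSemidef ↔ M.IsHermitian ∧ ∀ v, 0 ≤ (star v ⬝ᵥ (M *ᵥ v)).re := by
  refine ⟨fun h => ⟨h.1, fun v => (Complex.le_def.1 (h.dotProduct_mulVec_nonneg v)).1⟩,
    fun h => PosSemidef.of_dotProduct_mulVec_nonneg h.1 fun v => Complex.le_def.2 ⟨h.2 v, ?_⟩⟩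
  have := h.1.im_star_dotProduct_mulVec_self v
  exact this.symm

theorem one_sub_posSemidef_iff [DecidableEq n] {M : Matrix n n ℂ} (hM : M.IsHermitian) :
    (1 - M).PosSemidef ↔ ∀ v : n → ℂ, ∑ i, ‖v i‖ ^ 2 ≤ 1 → (star v ⬝ᵥ (M *ᵥ v)).re ≤ 1 := by
  have key : ∀ v : n → ℂ, (star v ⬝ᵥ ((1 - M) *ᵥ v)).re =
      ∑ i, ‖v i‖ ^ 2 - (star v ⬝ᵥ (M *ᵥ v)).re := by
    intro v
    rw [sub_mulVec, one_mulVec, dotProduct_sub, Complex.sub_re, star_dotProduct_self_re]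
  rw [posSemidef_iff_re]
  constructor
  · intro h v hv
    have := h.2 v
    rw [key] at this
    linarith
  · intro h
    refine ⟨isHermitian_one.sub hM, fun v => ?_⟩
    rw [key]
    set s := ∑ i, ‖v i‖ ^ 2 with hs
    rcases eq_or_lt_of_le (show 0 ≤ s by positivity) with h0 | h0
    · have hv : v = 0 := by
        funext i
        have := (Finset.sum_eq_zero_iff_of_nonneg (fun i _ => by positivity)).1 h0.symm i
          (Finset.mem_univ i)
        simpa using this
      simp [hv, ← h0]
    · have h1 := h (((Real.sqrt s)⁻¹ : ℂ) • v) (by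
        simp only [Pi.smul_apply, norm_smul, mul_pow, ← Finset.mul_sum, ← hs]
        rw [norm_inv, Complex.norm_real, Real.norm_of_nonneg (Real.sqrt_nonneg _), inv_pow,
          Real.sq_sqrt h0.le, inv_mul_cancel₀ h0.ne'])
      rw [mulVec_smul, dotProduct_smul, star_smul, smul_dotProduct, smul_smul] at h1
      have h2 : ((Real.sqrt s : ℂ)⁻¹ * star ((Real.sqrt s : ℂ)⁻¹)) = ((s⁻¹ : ℝ) : ℂ) := by
        rw [RCLike.star_def, map_inv₀, Complex.conj_ofReal, ← mul_inv, ← Complex.ofReal_mul,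
          Real.mul_self_sqrt h0.le, Complex.ofReal_inv]
      rw [h2, smul_eq_mul, Complex.re_ofReal_mul, inv_mul_le_iff₀ h0] at h1
      linarith

theorem one_sub_vecMulVec_posSemidef [DecidableEq n] {v : n → ℂ} (hv : ∑ i, ‖v i‖ ^ 2 ≤ 1) :
    (1 - vecMulVec v (star v)).PosSemidef := by
  rw [one_sub_posSemidef_iff (isHermitian_vecMulVec v)]
  intro w hw
  rw [star_dotProduct_vecMulVec, Complex.ofReal_re]
  exact (norm_star_dotProduct_sq_le v w).trans (mul_le_one₀ hv (by positivity) hw)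

theorem PosSemidef.exists_factor [DecidableEq n] {X : Matrix n n ℂ} (hX : X.PosSemidef) :
    ∃ R : Matrix n n ℂ, X = Rᴴ * R := by
  open scoped MatrixOrder in
  obtain ⟨R, hR⟩ := CStarAlgebra.nonneg_iff_eq_star_mul_self.1 hX.nonneg
  exact ⟨R, hR⟩

/-- Crude, but enough to make closed sets of positive matrices of bounded trace compact. -/
theorem PosSemidef.norm_apply_le [DecidableEq n] {X : Matrix n n ℂ} (hX : X.PosSemidef) (i j : n) :
    ‖X i j‖ ≤ X.trace.re := by
  obtain ⟨R, rfl⟩ := PosSemidef.exists_factor hX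
  have hd : ∀ i, ((Rᴴ * R) i i).re = ∑ k, ‖R k i‖ ^ 2 := fun i => by
    simpa [mul_apply, dotProduct] using star_dotProduct_self_re (fun k => R k i)
  have htr : (Rᴴ * R).trace.re = ∑ i, ∑ k, ‖R k i‖ ^ 2 := by
    simp only [trace, diag_apply, Complex.re_sum, hd]
  rw [htr]
  have hle : ∀ i, ∑ k, ‖R k i‖ ^ 2 ≤ ∑ i, ∑ k, ‖R k i‖ ^ 2 := fun i =>
    Finset.single_le_sum (f := fun i => ∑ k, ‖R k i‖ ^ 2) (fun _ _ => by positivity)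
      (Finset.mem_univ i)
  calc ‖(Rᴴ * R) i j‖ ≤ ∑ k, ‖R k i‖ * ‖R k j‖ := by
        rw [mul_apply]
        refine (norm_sum_le _ _).trans (Finset.sum_le_sum fun k _ => ?_)
        simp
    _ ≤ ∑ k, (‖R k i‖ ^ 2 + ‖R k j‖ ^ 2) / 2 := Finset.sum_le_sum fun k _ => by
        nlinarith [sq_nonneg (‖R k i‖ - ‖R k j‖)]
    _ ≤ _ := by
        rw [← Finset.sum_div, Finset.sum_add_distrib]
        linarith [hle i, hle j]

/-- A vector dominated by a positive matrix `X` is in the range of `X`. -/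
theorem exists_mulVec_eq_of_dominated [DecidableEq n] {X : Matrix n n ℂ}
    {a : n → ℂ} (ha : (X - vecMulVec a (star a)).PosSemidef) : ∃ u, X *ᵥ u = a := by
  by_contra hcon
  have hnot : a ∉ LinearMap.range X.mulVecLin := by
    rintro ⟨u, hu⟩
    exact hcon ⟨u, by simpa using hu⟩
  -- A functional killing the range of `X` but not `a`: domination tested on the vector representing
  -- it would give `0 ≤ -‖f a‖ ^ 2`.
  obtain ⟨f, hf, hker⟩ := Submodule.exists_le_ker_of_notMem hnot
  let y : n → ℂ := fun i => f (Pi.single i 1)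
  have hfy : ∀ z, f z = y ⬝ᵥ z := by
    intro z
    rw [dotProduct_comm, f.pi_apply_eq_sum_univ z]
    simp only [dotProduct, smul_eq_mul, y]
    refine Finset.sum_congr rfl fun i _ => ?_
    congr 2
    funext j
    simp [Pi.single_apply, eq_comm]
  have h1 : star (star y) ⬝ᵥ (X *ᵥ star y) = 0 := by
    rw [star_star, ← hfy]
    exact hker ⟨star y, by simp⟩
  have h2 := (posSemidef_iff_re.1 ha).2 (star y)
  rw [sub_mulVec, dotProduct_sub, h1, star_dotProduct_vecMulVec, zero_sub, Complex.neg_re,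
    Complex.ofReal_re, star_dotProduct_star, ← hfy, norm_star] at h2
  have h3 : ‖f a‖ ^ 2 ≤ 0 := by linarith
  exact hf (by simpa using h3)

theorem exists_conjTranspose_mul_self_eq_one [DecidableEq n] {k : Type*} [Fintype k]
    [DecidableEq k] (h : Fintype.card n ≤ Fintype.card k) : ∃ E : Matrix k n ℂ, Eᴴ * E = 1 := by
  obtain ⟨e⟩ := Function.Embedding.nonempty_iff_card_le.2 h
  refine ⟨of fun r x => if e x = r then 1 else 0, ?_⟩
  ext x y
  simp [mul_apply, one_apply, e.injective.eq_iff, eq_comm]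

end Quadratic

/-! ### Block matrices over an operator system -/

section Blocks

variable {ι κ : Type*} {d k m : ℕ}

/-- The `(p, q)` block. -/
def block (X : Matrix (ι × Fin d) (ι × Fin d) ℂ) (p q : ι) : Mat d :=
  of fun i j => X (p, i) (q, j)

@[simp] theorem block_apply (X : Matrix (ι × Fin d) (ι × Fin d) ℂ) (p q : ι) (i j : Fin d) :
    block X p q i j = X (p, i) (q, j) := rfl

/-- Positive block matrices with blocks in `S` whose diagonal blocks sum to the identity. -/
structure IsFeasible [Fintype ι] (S : Submodule ℂ (Mat d))
    (X : Matrix (ι × Fin d) (ι × Fin d) ℂ) : Prop where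
  posSemidef : X.PosSemidef
  block_mem : ∀ p q, block X p q ∈ S
  sum_block : ∑ p, block X p p = 1

/-- The rank one positive matrix `a a*` is below `X`. -/
def IsDominated [Fintype ι] (X : Matrix (ι × Fin d) (ι × Fin d) ℂ) (a : ι × Fin d → ℂ) : Prop :=
  (X - vecMulVec a (star a)).PosSemidef

/-- `∑ ⟨a_p, T a_p⟩`. -/
noncomputable def weight [Fintype ι] (T : Mat d) (a : ι × Fin d → ℂ) : ℝ :=
  ∑ p, (star (fun i => a (p, i)) ⬝ᵥ (T *ᵥ fun i => a (p, i))).re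

/-- The positive matrices whose weight is at most one on all dominated vectors. -/
def weightPolar (S : Submodule ℂ (Mat d)) (m : ℕ) : Set (Mat d) :=
  {T | T.PosSemidef ∧ ∀ (X : Matrix (Fin m × Fin d) (Fin m × Fin d) ℂ) (a : Fin m × Fin d → ℂ),
    IsFeasible S X → IsDominated X a → weight T a ≤ 1}

/-- The `p`-th block of columns. -/
def colBlock (R : Matrix κ (ι × Fin d) ℂ) (p : ι) : Matrix κ (Fin d) ℂ :=
  of fun r i => R r (p, i)

theorem block_conjTranspose_mul_self [Fintype κ] (R : Matrix κ (ι × Fin d) ℂ) (p q : ι) :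
    block (Rᴴ * R) p q = (colBlock R p)ᴴ * colBlock R q := by
  ext i j
  simp [mul_apply, colBlock]

/-- The `p`-th block of `Rᴴ v` is `(A p)ᴴ v`, so quadratic forms of `Φ(T)` become weights. -/
theorem weight_conjTranspose_mulVec [Fintype ι] [Fintype κ] (T : Mat d)
    (R : Matrix κ (ι × Fin d) ℂ) (v : κ → ℂ) :
    weight T (Rᴴ *ᵥ v) =
      (star v ⬝ᵥ ((∑ p, colBlock R p * T * (colBlock R p)ᴴ) *ᵥ v)).re := by
  rw [sum_mulVec, dotProduct_sum, Complex.re_sum]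
  refine Finset.sum_congr rfl fun p _ => ?_
  have h : (fun i => (Rᴴ *ᵥ v) (p, i)) = (colBlock R p)ᴴ *ᵥ v := by
    funext i
    simp [mulVec, dotProduct, colBlock]
  rw [h, star_mulVec, conjTranspose_conjTranspose, ← dotProduct_mulVec, mulVec_mulVec,
    mulVec_mulVec]

/-- Conjugate `v v* ≤ 1` by `R`. -/
theorem isDominated_conjTranspose_mulVec [Fintype ι] [Fintype κ] [DecidableEq κ]
    (R : Matrix κ (ι × Fin d) ℂ) {v : κ → ℂ} (hv : ∑ i, ‖v i‖ ^ 2 ≤ 1) :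
    IsDominated (Rᴴ * R) (Rᴴ *ᵥ v) := by
  have h := (one_sub_vecMulVec_posSemidef hv).conjTranspose_mul_mul_same R
  rw [Matrix.mul_sub, Matrix.sub_mul, Matrix.mul_one, mul_vecMulVec, vecMulVec_mul] at h
  rwa [IsDominated, star_mulVec, conjTranspose_conjTranspose]

/-- The map with given Kraus operators. -/
def krausMap (A : Fin m → Matrix (Fin k) (Fin d) ℂ) : SuperOp d k where
  toFun T := ∑ p, A p * T * (A p)ᴴ
  map_add' X Y := by simp only [Matrix.mul_add, Matrix.add_mul, Finset.sum_add_distrib]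
  map_smul' c X := by
    simp only [Matrix.mul_smul, Matrix.smul_mul, Finset.smul_sum, RingHom.id_apply]

theorem isKraus_krausMap (A : Fin m → Matrix (Fin k) (Fin d) ℂ) : IsKraus (krausMap A) A :=
  fun _ => rfl

theorem IsKraus.posSemidef {Φ : SuperOp d k} {A : Fin m → Matrix (Fin k) (Fin d) ℂ}
    (h : IsKraus Φ A) {T : Mat d} (hT : T.PosSemidef) : (Φ T).PosSemidef := by
  rw [h]
  exact posSemidef_sum _ fun p _ => hT.mul_mul_conjTranspose_same _

/-- The amplification has Kraus operators `1 ⊗ A p`. -/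
theorem IsKraus.isCompletelyPositive {Φ : SuperOp d k} {A : Fin m → Matrix (Fin k) (Fin d) ℂ}
    (h : IsKraus Φ A) : IsCompletelyPositive Φ := by
  intro n X hX
  have key : amplify Φ n X = ∑ p, (kroneckerMap (· * ·) (1 : Matrix (Fin n) (Fin n) ℂ) (A p)) * X *
      (kroneckerMap (· * ·) (1 : Matrix (Fin n) (Fin n) ℂ) (A p))ᴴ := by
    ext ⟨s, a⟩ ⟨t, b⟩
    simp only [amplify, of_apply, h _, Matrix.sum_apply]
    refine Finset.sum_congr rfl fun p _ => ?_
    simp only [mul_apply, Fintype.sum_prod_type, kroneckerMap_apply, conjTranspose_apply, one_apply,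
      ite_mul, one_mul, zero_mul, Finset.sum_mul]
    rw [Finset.sum_eq_single t]
    · simp
    · intro x _ hx
      simp [hx.symm]
    · simp
  rw [key]
  exact posSemidef_sum _ fun p _ => hX.mul_mul_conjTranspose_same _

theorem IsKraus.trace_eq {Φ : SuperOp d k} {A : Fin m → Matrix (Fin k) (Fin d) ℂ}
    (h : IsKraus Φ A) (T : Mat d) : (Φ T).trace = ((∑ p, (A p)ᴴ * A p) * T).trace := by
  rw [h, trace_sum, Finset.sum_mul, trace_sum]
  refine Finset.sum_congr rfl fun p _ => ?_
  rw [trace_mul_comm, Matrix.mul_assoc]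

theorem IsKraus.tracePreserving_iff {Φ : SuperOp d k} {A : Fin m → Matrix (Fin k) (Fin d) ℂ}
    (h : IsKraus Φ A) : (∀ T : Mat d, (Φ T).trace = T.trace) ↔ ∑ p, (A p)ᴴ * A p = 1 := by
  constructor
  · intro ht
    refine Matrix.ext_iff_trace_mul_right.2 fun T => ?_
    rw [← h.trace_eq, ht, Matrix.one_mul]
  · intro hA T
    rw [h.trace_eq, hA, Matrix.one_mul]

theorem mem_channelsInto_iff {S : Submodule ℂ (Mat d)} {Φ : SuperOp d k}
    {A : Fin m → Matrix (Fin k) (Fin d) ℂ} (h : IsKraus Φ A) :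
    Φ ∈ channelsInto S k ↔ ∑ p, (A p)ᴴ * A p = 1 ∧ ∀ p q, (A p)ᴴ * A q ∈ S := by
  rw [channelsInto, Set.mem_ofPred_eq, IsQuantumChannel, h.tracePreserving_iff, channelGraph_eq h,
    Submodule.span_le, Set.range_subset_iff, Prod.forall]
  exact ⟨fun H => ⟨H.1.2, H.2⟩, fun H => ⟨⟨h.isCompletelyPositive, H.1⟩, H.2⟩⟩

theorem mem_thCornerAt_of_forall_mem_weightPolar {S : Submodule ℂ (Mat d)} {T : Mat d}
    (hT : ∀ m, T ∈ weightPolar S m) (k : ℕ) : T ∈ thCornerAt S k := by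
  refine ⟨(hT 0).1, fun Φ hΦ => ?_⟩
  obtain ⟨m, A, hA⟩ := exists_isKraus hΦ.1.1
  rw [one_sub_posSemidef_iff (hA.posSemidef (hT 0).1).1]
  intro v hv
  let R : Matrix (Fin k) (Fin m × Fin d) ℂ := of fun r x => A x.1 r x.2
  have hR : ∀ p, colBlock R p = A p := fun p => rfl
  have h := (mem_channelsInto_iff hA).1 hΦ
  have h2 := (hT m).2 (Rᴴ * R) (Rᴴ *ᵥ v) ⟨posSemidef_conjTranspose_mul_self R,
    fun p q => by rw [block_conjTranspose_mul_self]; exact h.2 p q,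
    by simp only [block_conjTranspose_mul_self]; exact h.1⟩ (isDominated_conjTranspose_mulVec R hv)
  rwa [weight_conjTranspose_mulVec, show ∑ p, colBlock R p * T * (colBlock R p)ᴴ = Φ T from
    (hA T).symm] at h2

/-- Factoring `X = Rᴴ * R` and cutting `R` into column blocks recovers Kraus operators of a channel.
The factor has `m * d` rows, hence the size condition on `k`. -/
theorem thCornerAt_subset_weightPolar {S : Submodule ℂ (Mat d)} (hk : m * d ≤ k) :
    thCornerAt S k ⊆ weightPolar S m := by
  rintro T ⟨hT, hΦ⟩
  refine ⟨hT, fun X a hX ha => ?_⟩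
  obtain ⟨R, hR⟩ := PosSemidef.exists_factor hX.posSemidef
  obtain ⟨u, hu⟩ := exists_mulVec_eq_of_dominated ha
  have hs : (star u ⬝ᵥ (X *ᵥ u)) = ((∑ i, ‖(R *ᵥ u) i‖ ^ 2 : ℝ) : ℂ) := by
    rw [hR, ← mulVec_mulVec, dotProduct_mulVec, ← star_mulVec, star_dotProduct_self]
  -- With `a = X u` and `s = ‖R u‖²`, domination tested on `u` reads `s² ≤ s`.
  have hs1 : ∑ i, ‖(R *ᵥ u) i‖ ^ 2 ≤ 1 := by
    have h1 := (posSemidef_iff_re.1 ha).2 u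
    rw [sub_mulVec, dotProduct_sub, star_dotProduct_vecMulVec, Complex.sub_re, hs] at h1
    have h2 : star a ⬝ᵥ u = star (star u ⬝ᵥ (X *ᵥ u)) := by
      rw [hu, ← star_dotProduct]
    rw [h2, norm_star, hs, Complex.norm_real, Real.norm_of_nonneg (by positivity)] at h1
    simp only [Complex.ofReal_re] at h1
    nlinarith [show (0:ℝ) ≤ ∑ i, ‖(R *ᵥ u) i‖ ^ 2 by positivity]
  -- An isometry pads the rows to exactly `k` without changing `Rᴴ * R`.
  obtain ⟨E, hE⟩ := exists_conjTranspose_mul_self_eq_one (n := Fin m × Fin d) (k := Fin k)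
    (by simpa using hk)
  have hER : (E * R)ᴴ * (E * R) = X := by
    rw [conjTranspose_mul, Matrix.mul_assoc, ← Matrix.mul_assoc Eᴴ, hE, Matrix.one_mul, hR]
  have hmem : krausMap (colBlock (E * R)) ∈ channelsInto S k := by
    rw [mem_channelsInto_iff (isKraus_krausMap _)]
    simp only [← block_conjTranspose_mul_self, hER]
    exact ⟨hX.sum_block, hX.block_mem⟩
  have h1 := hΦ _ hmem
  rw [one_sub_posSemidef_iff ((isKraus_krausMap _).posSemidef hT).1] at h1
  have h2 := h1 (E *ᵥ (R *ᵥ u)) (by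
    rw [← star_dotProduct_self_re, star_mulVec, ← dotProduct_mulVec, mulVec_mulVec, hE,
      one_mulVec, star_dotProduct_self_re]
    exact hs1)
  have h3 : (E * R)ᴴ *ᵥ (E *ᵥ (R *ᵥ u)) = a := by
    rw [mulVec_mulVec, mulVec_mulVec, Matrix.mul_assoc, hER, hu]
  rw [← h3, weight_conjTranspose_mulVec]
  exact h2

end Blocks

/-! ### Reducing the number of blocks -/

section Compression

variable {d k m : ℕ}

/-- The weight depends on `a` only through the Gram matrix `Bᴴ * B` of the `m × d` array `B` of its
entries; this is what permits compressing the block index. -/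
theorem weight_eq_trace {ι : Type*} [Fintype ι] (T : Mat d) (a : ι × Fin d → ℂ) :
    weight T a = (T * ((of fun p i => a (p, i) : Matrix ι (Fin d) ℂ)ᴴ *
      (of fun p i => a (p, i) : Matrix ι (Fin d) ℂ))ᵀ).trace.re := by
  simp only [weight, trace, diag_apply, mul_apply, transpose_apply, conjTranspose_apply, of_apply,
    dotProduct, mulVec, ← Complex.re_sum, Finset.mul_sum, Pi.star_apply]
  congr 1
  rw [Finset.sum_comm]
  refine Finset.sum_congr rfl fun i _ => ?_
  rw [Finset.sum_comm]
  refine Finset.sum_congr rfl fun j _ => Finset.sum_congr rfl fun p _ => ?_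
  ring

/-- `Vᴴ * V` is the orthogonal projection onto the column space of `B`, of dimension at most `d`. An
orthonormal basis gives the rows, zero-padding makes them `d` in number, and Bessel's inequality
gives the bound. -/
theorem exists_partial_isometry (B : Matrix (Fin m) (Fin d) ℂ) :
    ∃ V : Matrix (Fin d) (Fin m) ℂ, Vᴴ * V * B = B ∧ (1 - Vᴴ * V).PosSemidef := by
  let K : Submodule ℂ (EuclideanSpace ℂ (Fin m)) :=
    Submodule.span ℂ (Set.range fun i => WithLp.toLp 2 (fun p => B p i))
  have hK : Module.finrank ℂ K ≤ d := (finrank_range_le_card _).trans (by simp)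
  let b := stdOrthonormalBasis ℂ K
  let V : Matrix (Fin (Module.finrank ℂ K)) (Fin m) ℂ := of fun s p => star ((b s).1 p)
  have hV : ∀ x : EuclideanSpace ℂ (Fin m), ∀ s, (V *ᵥ x.ofLp) s = inner ℂ (b s).1 x := by
    intro x s
    rw [EuclideanSpace.inner_eq_star_dotProduct, dotProduct_comm]
    rfl
  obtain ⟨E, hE⟩ := exists_conjTranspose_mul_self_eq_one (n := Fin (Module.finrank ℂ K))
    (k := Fin d) (by simpa using hK)
  have hEV : (E * V)ᴴ * (E * V) = Vᴴ * V := by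
    rw [conjTranspose_mul, Matrix.mul_assoc, ← Matrix.mul_assoc Eᴴ, hE, Matrix.one_mul]
  refine ⟨E * V, ?_, ?_⟩
  · rw [hEV]
    ext p i
    have hmem : WithLp.toLp 2 (fun p => B p i) ∈ K := Submodule.subset_span ⟨i, rfl⟩
    have h1 := congrArg Subtype.val (b.sum_repr ⟨_, hmem⟩)
    have h2 := congrArg (fun x : EuclideanSpace ℂ (Fin m) => x p) h1
    simp only [AddSubmonoidClass.coe_finsetSum, SetLike.val_smul, WithLp.ofLp_sum, WithLp.ofLp_smul,
      Finset.sum_apply, Pi.smul_apply, smul_eq_mul] at h2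
    rw [Matrix.mul_assoc, mul_apply, ← h2]
    refine Finset.sum_congr rfl fun s _ => ?_
    have h3 := hV (WithLp.toLp 2 (fun p => B p i)) s
    rw [OrthonormalBasis.repr_apply_apply, Submodule.coe_inner, ← h3, mul_comm]
    simp [V, mul_apply, mulVec, dotProduct]
  · rw [hEV, one_sub_posSemidef_iff (isHermitian_conjTranspose_mul_self V)]
    intro v hv
    rw [← mulVec_mulVec, dotProduct_mulVec, ← star_mulVec, star_dotProduct_self_re]
    have hon : Orthonormal ℂ fun s => (b s).1 := b.orthonormal.comp_linearIsometry K.subtypeₗᵢ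
    have h := hon.sum_inner_products_le (x := WithLp.toLp 2 v) (s := Finset.univ)
    rw [EuclideanSpace.norm_sq_eq] at h
    refine le_trans (le_of_eq ?_) (h.trans hv)
    exact Finset.sum_congr rfl fun s _ => by rw [← hV]

/-- The matrix of `v ⊗ 1`, for a row vector `v`. -/
def rowAmp (d : ℕ) (v : Fin m → ℂ) : Matrix (Fin d) (Fin m × Fin d) ℂ :=
  of fun i x => if i = x.2 then v x.1 else 0

theorem rowAmp_mul_mul (X : Matrix (Fin m × Fin d) (Fin m × Fin d) ℂ) (v w : Fin m → ℂ) :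
    rowAmp d v * X * (rowAmp d w)ᴴ = ∑ p, ∑ q, (v p * star (w q)) • block X p q := by
  ext i j
  simp only [Matrix.sum_apply, Matrix.smul_apply, smul_eq_mul, mul_apply, rowAmp, of_apply,
    conjTranspose_apply, Fintype.sum_prod_type, block_apply, ite_mul, zero_mul, Finset.sum_ite_eq,
    Finset.mem_univ, if_true, apply_ite star, star_zero, mul_ite, mul_zero, Finset.sum_mul]
  rw [Finset.sum_comm]
  refine Finset.sum_congr rfl fun p _ => Finset.sum_congr rfl fun q _ => ?_
  ring

/-- The matrix of `V ⊗ 1`. -/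
def rowsAmp (d : ℕ) (V : Matrix (Fin k) (Fin m) ℂ) : Matrix (Fin k × Fin d) (Fin m × Fin d) ℂ :=
  of fun x y => rowAmp d (V x.1) x.2 y

theorem block_rowsAmp (X : Matrix (Fin m × Fin d) (Fin m × Fin d) ℂ)
    (V : Matrix (Fin k) (Fin m) ℂ) (s t : Fin k) :
    block (rowsAmp d V * X * (rowsAmp d V)ᴴ) s t = rowAmp d (V s) * X * (rowAmp d (V t))ᴴ := by
  ext i j
  simp [rowsAmp, mul_apply]

/-- Compress the block index by `V ⊗ 1`, where `V` is isometric on the columns of `a`, so the weight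
survives. New blocks are combinations of old ones and stay in `S`. The diagonal mass lost to `1 - Vᴴ
* V` is a positive element of `S` and is put back into one diagonal block; adding it preserves
domination. -/
theorem weightPolar_subset (S : Submodule ℂ (Mat d)) (m : ℕ) :
    weightPolar S d ⊆ weightPolar S m := by
  rintro T ⟨hT, h⟩
  refine ⟨hT, fun X a hX ha => ?_⟩
  rcases Nat.eq_zero_or_pos d with rfl | hd
  · simp [weight]
  obtain ⟨V, hVB, hV1⟩ := exists_partial_isometry (of fun p i => a (p, i) : Matrix _ (Fin d) ℂ)
  obtain ⟨N, hN⟩ := PosSemidef.exists_factor hV1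
  -- The block which receives the lost mass; any one would do.
  let o : Fin d := ⟨0, hd⟩
  let Y : Mat d := ∑ r, rowAmp d (N r) * X * (rowAmp d (N r))ᴴ
  have hY : Y.PosSemidef := posSemidef_sum _ fun r _ => hX.posSemidef.mul_mul_conjTranspose_same _
  let Z : Matrix (Fin d × Fin d) (Fin d × Fin d) ℂ :=
    kroneckerMap (· * ·) (diagonal (Pi.single o (1 : ℂ))) Y
  have hZ : Z.PosSemidef := (PosSemidef.diagonal (by
    intro i
    by_cases hi : i = o
    · subst hi; simp
    · simp [hi])).kronecker hY
  have hmem : ∀ v w : Fin m → ℂ, rowAmp d v * X * (rowAmp d w)ᴴ ∈ S := by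
    intro v w
    rw [rowAmp_mul_mul]
    exact S.sum_mem fun p _ => S.sum_mem fun q _ => S.smul_mem _ (hX.block_mem p q)
  have hYS : Y ∈ S := S.sum_mem fun r _ => hmem _ _
  have hZb : ∀ s t, block Z s t = (diagonal (Pi.single o (1 : ℂ)) : Mat d) s t • Y := by
    intro s t
    ext i j
    simp [Z]
  have hsum : ∑ s, rowAmp d (V s) * X * (rowAmp d (V s))ᴴ + Y = 1 := by
    have hVN : ∀ p q, ∑ s, V s p * star (V s q) + ∑ r, N r p * star (N r q) =
        (1 : Matrix (Fin m) (Fin m) ℂ) q p := by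
      intro p q
      have h1 := congrArg (fun M : Matrix (Fin m) (Fin m) ℂ => M q p) (add_eq_of_eq_sub' hN.symm)
      simp only [Matrix.add_apply, mul_apply, conjTranspose_apply] at h1
      rw [← h1]
      simp only [mul_comm]
    have h2 : ∀ {n : ℕ} (W : Matrix (Fin n) (Fin m) ℂ),
        ∑ s, rowAmp d (W s) * X * (rowAmp d (W s))ᴴ =
          ∑ p, ∑ q, (∑ s, W s p * star (W s q)) • block X p q := by
      intro n W
      simp only [rowAmp_mul_mul, Finset.sum_smul]
      rw [Finset.sum_comm]
      refine Finset.sum_congr rfl fun p _ => ?_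
      rw [Finset.sum_comm]
    rw [h2, show Y = _ from h2 N, ← Finset.sum_add_distrib, ← hX.sum_block]
    refine Finset.sum_congr rfl fun p _ => ?_
    rw [← Finset.sum_add_distrib]
    simp only [← add_smul, hVN, one_apply, ite_smul, one_smul, zero_smul]
    simp
  have hX' : IsFeasible S (rowsAmp d V * X * (rowsAmp d V)ᴴ + Z) := by
    refine ⟨(hX.posSemidef.mul_mul_conjTranspose_same _).add hZ, fun s t => ?_, ?_⟩
    · have : block (rowsAmp d V * X * (rowsAmp d V)ᴴ + Z) s t =
          block (rowsAmp d V * X * (rowsAmp d V)ᴴ) s t + block Z s t := rfl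
      rw [this, block_rowsAmp, hZb]
      exact S.add_mem (hmem _ _) (S.smul_mem _ hYS)
    · have : ∀ s, block (rowsAmp d V * X * (rowsAmp d V)ᴴ + Z) s s =
          block (rowsAmp d V * X * (rowsAmp d V)ᴴ) s s + block Z s s := fun s => rfl
      simp only [this, block_rowsAmp, hZb, Finset.sum_add_distrib, diagonal_apply_eq]
      rw [← Finset.sum_smul, Finset.sum_pi_single', if_pos (Finset.mem_univ o), one_smul, hsum]
  have ha' : IsDominated (rowsAmp d V * X * (rowsAmp d V)ᴴ + Z) (rowsAmp d V *ᵥ a) := by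
    have h1 := (PosSemidef.mul_mul_conjTranspose_same ha (rowsAmp d V)).add hZ
    rw [Matrix.mul_sub, Matrix.sub_mul, mul_vecMulVec, vecMulVec_mul, ← star_mulVec] at h1
    rwa [IsDominated, add_sub_right_comm]
  have hle := h _ _ hX' ha'
  have hVa : (of fun p i => (rowsAmp d V *ᵥ a) (p, i) : Matrix (Fin d) (Fin d) ℂ) =
      V * (of fun p i => a (p, i) : Matrix (Fin m) (Fin d) ℂ) := by
    ext s i
    simp [rowsAmp, rowAmp, mulVec, dotProduct, mul_apply, Fintype.sum_prod_type]
  rwa [weight_eq_trace, hVa, conjTranspose_mul, Matrix.mul_assoc, ← Matrix.mul_assoc Vᴴ, hVB,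
    ← weight_eq_trace] at hle

theorem thCornerAt_eq_weightPolar (S : Submodule ℂ (Mat d)) (hk : d ^ 2 ≤ k) :
    thCornerAt S k = weightPolar S d :=
  Set.Subset.antisymm (thCornerAt_subset_weightPolar (by rwa [← sq])) fun _ hT =>
    mem_thCornerAt_of_forall_mem_weightPolar (fun m => weightPolar_subset S m hT) k

theorem thCorner_eq_weightPolar (S : Submodule ℂ (Mat d)) : thCorner S = weightPolar S d := by
  refine Set.Subset.antisymm (fun T hT => ?_) fun T hT => ⟨hT.1, fun k Φ hΦ => ?_⟩
  · rw [← thCornerAt_eq_weightPolar S le_rfl]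
    exact ⟨hT.1, hT.2 _⟩
  · exact (mem_thCornerAt_of_forall_mem_weightPolar (fun m => weightPolar_subset S m hT) k).2 Φ hΦ

end Compression

/-! ### Closed and compact sets of matrices -/

section MatrixTopology

variable {n n' : Type*}

theorem isClosed_posSemidef [Fintype n] : IsClosed {M : Matrix n n ℂ | M.PosSemidef} := by
  have h : {M : Matrix n n ℂ | M.PosSemidef} =
      {M | Mᴴ = M} ∩ ⋂ v : n → ℂ, {M | 0 ≤ (star v ⬝ᵥ (M *ᵥ v)).re} := by
    ext M
    simp [posSemidef_iff_re, IsHermitian]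
  rw [h]
  refine (isClosed_eq (continuous_id.matrix_conjTranspose) continuous_id).inter
    (isClosed_iInter fun v => isClosed_le continuous_const ?_)
  exact Complex.continuous_re.comp
    (continuous_const.dotProduct (continuous_id.matrix_mulVec continuous_const))

theorem isCompact_norm_apply_le [Fintype n'] (c : ℝ) :
    IsCompact {M : Matrix n n' ℂ | ∀ i j, ‖M i j‖ ≤ c} := by
  have h : IsCompact (X := Matrix n n' ℂ) (Set.univ.pi fun _ : n => Set.univ.pi fun _ : n' =>
      Metric.closedBall (0 : ℂ) c) :=
    isCompact_univ_pi fun _ => isCompact_univ_pi fun _ => isCompact_closedBall _ _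
  refine (congrArg IsCompact (Set.ext fun M => ?_)).mpr h
  exact ⟨fun hM i _ j _ => mem_closedBall_zero_iff.2 (hM i j),
    fun hM i j => mem_closedBall_zero_iff.1 (hM i (Set.mem_univ _) j (Set.mem_univ _))⟩

instance locallyConvexSpace_matrix : LocallyConvexSpace ℝ (Matrix n n' ℂ) :=
  inferInstanceAs (LocallyConvexSpace ℝ (n → n' → ℂ))

end MatrixTopology

/-! ### Extreme channels -/

section Choi

variable {d k m : ℕ}

/-- The Choi matrix. -/
def choi (d k : ℕ) : SuperOp d k ≃ₗ[ℂ] Matrix (Fin d × Fin k) (Fin d × Fin k) ℂ where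
  toFun Φ := of fun x y => Φ (Matrix.single x.1 y.1 1) x.2 y.2
  map_add' Φ Ψ := by ext; simp
  map_smul' c Φ := by ext; simp
  invFun C :=
    { toFun := fun T => of fun a b => ∑ i, ∑ j, T i j * C (i, a) (j, b)
      map_add' := fun T T' => by ext; simp [add_mul, Finset.sum_add_distrib]
      map_smul' := fun c T => by ext; simp [mul_assoc, Finset.mul_sum] }
  left_inv Φ := by
    refine Matrix.ext_linearMap _ fun i j => LinearMap.ext_ring ?_
    ext a b
    simp [Matrix.single, ite_and]
  right_inv C := by
    ext ⟨i, a⟩ ⟨j, b⟩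
    simp [Matrix.single, ite_and]

theorem choi_symm_apply (C : Matrix (Fin d × Fin k) (Fin d × Fin k) ℂ) (T : Mat d) (a b : Fin k) :
    (choi d k).symm C T a b = ∑ i, ∑ j, T i j * C (i, a) (j, b) := rfl

/-- The entries of a Kraus operator. -/
def vecKraus (A : Matrix (Fin k) (Fin d) ℂ) : Fin d × Fin k → ℂ := fun x => A x.2 x.1

theorem choi_krausMap (A : Fin m → Matrix (Fin k) (Fin d) ℂ) :
    choi d k (krausMap A) = ∑ p, vecMulVec (vecKraus (A p)) (star (vecKraus (A p))) := by
  ext ⟨i, a⟩ ⟨j, b⟩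
  simp [choi, krausMap, Matrix.sum_apply, vecMulVec, vecKraus, mul_apply, Matrix.single, ite_and]

theorem isKraus_iff_choi {Φ : SuperOp d k} {A : Fin m → Matrix (Fin k) (Fin d) ℂ} :
    IsKraus Φ A ↔ choi d k Φ = ∑ p, vecMulVec (vecKraus (A p)) (star (vecKraus (A p))) := by
  rw [← choi_krausMap, (choi d k).injective.eq_iff]
  exact ⟨fun h => LinearMap.ext h, fun h T => LinearMap.congr_fun h T⟩

theorem isCompletelyPositive_iff_choi {Φ : SuperOp d k} :
    IsCompletelyPositive Φ ↔ (choi d k Φ).PosSemidef := by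
  constructor
  · intro h
    obtain ⟨m, A, hA⟩ := exists_isKraus h
    rw [isKraus_iff_choi.1 hA]
    exact posSemidef_sum _ fun p _ => posSemidef_vecMulVec_self_star _
  · intro h
    obtain ⟨m, v, hv⟩ := Matrix.posSemidef_iff_eq_sum_vecMulVec.1 h
    have hA : IsKraus Φ fun p => (of fun a i => v p (i, a) : Matrix (Fin k) (Fin d) ℂ) :=
      isKraus_iff_choi.2 hv
    exact hA.isCompletelyPositive

theorem tracePreserving_iff_choi {Φ : SuperOp d k} :
    (∀ T : Mat d, (Φ T).trace = T.trace) ↔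
      ∀ i j, ∑ a, choi d k Φ (i, a) (j, a) = (1 : Mat d) i j := by
  have key : ∀ i j, ∑ a, choi d k Φ (i, a) (j, a) = (Φ (Matrix.single i j 1)).trace :=
    fun i j => rfl
  constructor
  · intro h i j
    rw [key, h]
    by_cases hij : i = j
    · subst hij; simp
    · simp [hij]
  · intro h T
    have h1 : (traceLinearMap (Fin k) ℂ ℂ) ∘ₗ Φ = traceLinearMap (Fin d) ℂ ℂ := by
      refine Matrix.ext_linearMap _ fun i j => LinearMap.ext_ring ?_
      have h2 := h i j
      rw [key] at h2
      by_cases hij : i = j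
      · subst hij; simpa using h2
      · simpa [hij] using h2
    exact LinearMap.congr_fun h1 T

/-- The Choi matrices of quantum channels. -/
def choiChannels (d k : ℕ) : Set (Matrix (Fin d × Fin k) (Fin d × Fin k) ℂ) :=
  {C | C.PosSemidef ∧ ∀ i j, ∑ a, C (i, a) (j, a) = (1 : Mat d) i j}

theorem isQuantumChannel_iff_choi {Φ : SuperOp d k} :
    IsQuantumChannel Φ ↔ choi d k Φ ∈ choiChannels d k := by
  rw [IsQuantumChannel, isCompletelyPositive_iff_choi, tracePreserving_iff_choi]
  rfl

/-- The channels whose Choi matrix vanishes on the kernel of `C₀`. -/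
def choiFace (C₀ : Matrix (Fin d × Fin k) (Fin d × Fin k) ℂ) :
    Set (Matrix (Fin d × Fin k) (Fin d × Fin k) ℂ) :=
  {C | C ∈ choiChannels d k ∧ ∀ x, C₀ *ᵥ x = 0 → C *ᵥ x = 0}

/-- Trace preservation fixes the trace of the Choi matrix at `d`, which bounds every entry. -/
theorem isCompact_choiFace (C₀ : Matrix (Fin d × Fin k) (Fin d × Fin k) ℂ) :
    IsCompact (choiFace C₀) := by
  refine (isCompact_norm_apply_le (d : ℝ)).of_isClosed_subset ?_ ?_
  · have h : choiFace C₀ = ({C | C.PosSemidef} ∩ ⋂ i, ⋂ j, {C | ∑ a, C (i, a) (j, a) =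
        (1 : Mat d) i j}) ∩ ⋂ x, ⋂ (_ : C₀ *ᵥ x = 0), {C | C *ᵥ x = 0} := by
      ext C
      simp [choiFace, choiChannels]
    rw [h]
    refine (isClosed_posSemidef.inter (isClosed_iInter fun i => isClosed_iInter fun j =>
      isClosed_eq ?_ continuous_const)).inter (isClosed_iInter fun x => isClosed_iInter fun _ =>
      isClosed_eq (continuous_id.matrix_mulVec continuous_const) continuous_const)
    exact continuous_finsetSum _ fun a _ => continuous_id.matrix_elem _ _
  · rintro C ⟨⟨hC, htr⟩, -⟩ x y
    refine (PosSemidef.norm_apply_le hC x y).trans (le_of_eq ?_)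
    simp only [trace, diag_apply, Fintype.sum_prod_type, htr]
    simp

theorem convex_choiFace (C₀ : Matrix (Fin d × Fin k) (Fin d × Fin k) ℂ) :
    Convex ℝ (choiFace C₀) := by
  rintro C ⟨⟨hC, hCt⟩, hCk⟩ D ⟨⟨hD, hDt⟩, hDk⟩ s t hs ht hst
  refine ⟨⟨(hC.smul hs).add (hD.smul ht), fun i j => ?_⟩, fun x hx => ?_⟩
  · simp only [Matrix.add_apply, Matrix.smul_apply, Finset.sum_add_distrib, ← Finset.smul_sum, hCt,
      hDt]
    rw [← add_smul, hst, one_smul]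
  · rw [add_mulVec, smul_mulVec, smul_mulVec, hCk x hx, hDk x hx]
    simp

/-- If a positive combination of two nonnegative quadratic forms vanishes at `x`, both do, and a
positive matrix with `⟨x, C x⟩ = 0` kills `x`. -/
theorem isExtreme_choiFace (C₀ : Matrix (Fin d × Fin k) (Fin d × Fin k) ℂ) :
    IsExtreme ℝ (choiChannels d k) (choiFace C₀) := by
  refine ⟨fun C hC => hC.1, ?_⟩
  rintro C hC D hD E ⟨-, hE⟩ ⟨s, t, hs, ht, -, rfl⟩
  refine ⟨hC, fun x hx => ?_⟩
  have h1 := hE x hx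
  have h2 : (star x ⬝ᵥ ((s • C + t • D) *ᵥ x)).re = 0 := by rw [h1]; simp
  rw [add_mulVec, smul_mulVec, smul_mulVec, dotProduct_add, dotProduct_smul, dotProduct_smul,
    Complex.add_re, Complex.smul_re, Complex.smul_re, smul_eq_mul, smul_eq_mul] at h2
  have h3 := (posSemidef_iff_re.1 hC.1).2 x
  have h4 := (posSemidef_iff_re.1 hD.1).2 x
  have h5 : (star x ⬝ᵥ (C *ᵥ x)).re = 0 := by
    have := mul_nonneg ht.le h4
    nlinarith [mul_nonneg hs.le h3]
  exact (hC.1.dotProduct_mulVec_zero_iff x).1 (Complex.ext h5 (PosSemidef.im_zero hC.1 x))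

/-- A functional `f` vanishing on all `A p` is a kernel vector of the Choi matrix of `Φ`, hence of
that of `Ψ`, whose quadratic form there is `∑ ‖f (B q)‖ ^ 2`. -/
theorem mem_span_of_choiFace {l : ℕ} {Φ Ψ : SuperOp d k} {A : Fin m → Matrix (Fin k) (Fin d) ℂ}
    {B : Fin l → Matrix (Fin k) (Fin d) ℂ} (hA : IsKraus Φ A) (hB : IsKraus Ψ B)
    (h : ∀ x, choi d k Φ *ᵥ x = 0 → choi d k Ψ *ᵥ x = 0) (q : Fin l) :
    B q ∈ Submodule.span ℂ (Set.range A) := by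
  by_contra hq
  obtain ⟨f, hf, hker⟩ := Submodule.exists_le_ker_of_notMem hq
  let y : Fin d × Fin k → ℂ := fun x => f (Matrix.single x.2 x.1 1)
  have hfy : ∀ X, f X = y ⬝ᵥ vecKraus X := by
    intro X
    conv_lhs => rw [Matrix.matrix_eq_sum_single X]
    simp only [map_sum, dotProduct, Fintype.sum_prod_type, y, vecKraus]
    rw [Finset.sum_comm]
    refine Finset.sum_congr rfl fun i _ => Finset.sum_congr rfl fun a _ => ?_
    rw [show Matrix.single a i (X a i) = X a i • Matrix.single a i (1 : ℂ) by simp, map_smul,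
      smul_eq_mul, mul_comm]
  have hy : ∀ X, star (vecKraus X) ⬝ᵥ star y = star (f X) := by
    intro X
    rw [star_dotProduct_star, hfy]
  have h1 : choi d k Φ *ᵥ star y = 0 := by
    rw [isKraus_iff_choi.1 hA, sum_mulVec]
    refine Finset.sum_eq_zero fun p _ => ?_
    rw [vecMulVec_mulVec, hy, show f (A p) = 0 from hker (Submodule.subset_span ⟨p, rfl⟩)]
    simp
  have h2 : (star (star y) ⬝ᵥ (choi d k Ψ *ᵥ star y)).re = 0 := by rw [h _ h1]; simp
  rw [isKraus_iff_choi.1 hB, sum_mulVec, dotProduct_sum] at h2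
  simp only [star_dotProduct_vecMulVec, hy, Complex.re_sum, Complex.ofReal_re, norm_star] at h2
  have h3 := (Finset.sum_eq_zero_iff_of_nonneg fun i _ => by positivity).1 h2 q (Finset.mem_univ q)
  exact hf (by simpa using h3)

theorem conjTranspose_mul_mem_of_mem_span {S : Submodule ℂ (Mat d)}
    {A : Fin m → Matrix (Fin k) (Fin d) ℂ} (hA : ∀ p q, (A p)ᴴ * A q ∈ S)
    {X Y : Matrix (Fin k) (Fin d) ℂ} (hX : X ∈ Submodule.span ℂ (Set.range A))
    (hY : Y ∈ Submodule.span ℂ (Set.range A)) : Xᴴ * Y ∈ S := by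
  induction hX, hY using Submodule.span_induction₂ with
  | mem_mem x y hx hy =>
    obtain ⟨i, rfl⟩ := hx
    obtain ⟨j, rfl⟩ := hy
    exact hA i j
  | zero_left y hy => simp
  | zero_right x hx => simp
  | add_left x y z _ _ _ h1 h2 =>
    rw [conjTranspose_add, Matrix.add_mul]
    exact S.add_mem h1 h2
  | add_right x y z _ _ _ h1 h2 =>
    rw [Matrix.mul_add]
    exact S.add_mem h1 h2
  | smul_left r x y _ _ h1 =>
    rw [conjTranspose_smul, Matrix.smul_mul]
    exact S.smul_mem _ h1
  | smul_right r x y _ _ h1 =>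
    rw [Matrix.mul_smul]
    exact S.smul_mem _ h1

theorem mem_channelsInto_of_choiFace {S : Submodule ℂ (Mat d)} {Φ Ψ : SuperOp d k}
    (hΦ : Φ ∈ channelsInto S k) (hΨ : choi d k Ψ ∈ choiFace (choi d k Φ)) :
    Ψ ∈ channelsInto S k := by
  have hq := isQuantumChannel_iff_choi.2 hΨ.1
  obtain ⟨m, A, hA⟩ := exists_isKraus hΦ.1.1
  obtain ⟨l, B, hB⟩ := exists_isKraus hq.1
  refine (mem_channelsInto_iff hB).2 ⟨hB.tracePreserving_iff.1 hq.2, fun p q => ?_⟩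
  exact conjTranspose_mul_mem_of_mem_span ((mem_channelsInto_iff hA).1 hΦ).2
    (mem_span_of_choiFace hA hB hΨ.2 p) (mem_span_of_choiFace hA hB hΨ.2 q)

theorem choi_symm_mem_extremeChannels {C : Matrix (Fin d × Fin k) (Fin d × Fin k) ℂ}
    (hC : C ∈ Set.extremePoints ℝ (choiChannels d k)) :
    (choi d k).symm C ∈ extremeChannels d k := by
  let e := (choi d k).symm.restrictScalars ℝ
  have h := image_extremePoints e (choiChannels d k)
  have h2 : e '' choiChannels d k = {Φ | IsQuantumChannel Φ} := by
    ext Φ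
    constructor
    · rintro ⟨D, hD, rfl⟩
      refine isQuantumChannel_iff_choi.2 ?_
      simpa [e] using hD
    · intro hΦ
      exact ⟨choi d k Φ, isQuantumChannel_iff_choi.1 hΦ, by simp [e]⟩
  rw [h2] at h
  rw [extremeChannels, ← h]
  exact ⟨C, hC, rfl⟩

/-- Krein–Milman on the face generated by `Φ`: its extreme points are extreme among all channels and
their graphs lie in `S`, while `⟨v, Ψ(T) v⟩` is a continuous real-linear function of the Choi matrix
of `Ψ`. -/
theorem thCornerAt_eq_extremeChannels (S : Submodule ℂ (Mat d)) (k : ℕ) :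
    thCornerAt S k = {T | T.PosSemidef ∧ ∀ Ψ ∈ channelsInto S k ∩ extremeChannels d k,
      (1 - Ψ T).PosSemidef} := by
  refine Set.Subset.antisymm (fun T hT => ⟨hT.1, fun Ψ hΨ => hT.2 Ψ hΨ.1⟩) ?_
  rintro T ⟨hT, hext⟩
  refine ⟨hT, fun Φ hΦ => ?_⟩
  have hpos : ∀ {Ψ : SuperOp d k}, IsCompletelyPositive Ψ → (Ψ T).PosSemidef := by
    intro Ψ hΨ
    obtain ⟨m, A, hA⟩ := exists_isKraus hΨ
    exact hA.posSemidef hT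
  rw [one_sub_posSemidef_iff (hpos hΦ.1.1).1]
  intro v hv
  let g : Matrix (Fin d × Fin k) (Fin d × Fin k) ℂ →ₗ[ℝ] ℝ :=
    { toFun := fun C => (star v ⬝ᵥ ((choi d k).symm C T *ᵥ v)).re
      map_add' := fun C D => by
        rw [map_add, LinearMap.add_apply, add_mulVec, dotProduct_add, Complex.add_re]
      map_smul' := fun c C => by
        have : (choi d k).symm (c • C) = c • (choi d k).symm C :=
          ((choi d k).symm.restrictScalars ℝ).map_smul c C
        rw [this, LinearMap.smul_apply, smul_mulVec, dotProduct_smul, Complex.smul_re]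
        rfl }
  have hg : Continuous g := by
    refine Complex.continuous_re.comp (continuous_const.dotProduct
      (Continuous.matrix_mulVec ?_ continuous_const))
    refine continuous_matrix fun a b => ?_
    simp only [choi_symm_apply]
    exact continuous_finsetSum _ fun i _ => continuous_finsetSum _ fun j _ =>
      continuous_const.mul (continuous_id.matrix_elem _ _)
  have hsub : Set.extremePoints ℝ (choiFace (choi d k Φ)) ⊆ {C | g C ≤ 1} := by
    intro C hC
    have h1 := (isExtreme_choiFace (choi d k Φ)).extremePoints_subset_extremePoints hC
    have h2 := mem_channelsInto_of_choiFace (Ψ := (choi d k).symm C) hΦ (by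
      rw [LinearEquiv.apply_symm_apply]; exact hC.1)
    exact (one_sub_posSemidef_iff (hpos h2.1.1).1).1
      (hext _ ⟨h2, choi_symm_mem_extremeChannels h1⟩) v hv
  have hconv : Convex ℝ {C | g C ≤ 1} := convex_halfSpace_le g.isLinear 1
  have hcl : IsClosed {C | g C ≤ 1} := isClosed_le hg continuous_const
  have h3 := closure_minimal (convexHull_min hsub hconv) hcl
  rw [closure_convexHull_extremePoints (isCompact_choiFace _) (convex_choiFace _)] at h3
  have h4 : g (choi d k Φ) ≤ 1 := h3 ⟨isQuantumChannel_iff_choi.1 hΦ.1, fun _ hx => hx⟩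
  simpa [g] using h4

end Choi

/-! ### Kuratowski limits -/

section Kuratowski

variable {X : Type*} [TopologicalSpace X]

theorem setLiminf_subset_setLimsup (F : ℕ → Set X) : setLiminf F ⊆ setLimsup F :=
  fun _ ⟨u, hu, hx⟩ => ⟨u, hu, hx.mapClusterPt⟩

theorem kuratowskiTendsto_of_subset {F : ℕ → Set X} {L : Set X} (h₁ : L ⊆ setLiminf F)
    (h₂ : setLimsup F ⊆ L) : KuratowskiTendsto F L :=
  ⟨h₁.antisymm ((setLiminf_subset_setLimsup F).trans h₂),
    (h₁.trans (setLiminf_subset_setLimsup F)).antisymm h₂⟩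

theorem prop_of_mapClusterPt {α : Type*} {l : Filter α} {u : α → X} {x : X} (P : X → Prop)
    (h : MapClusterPt x l u) (hC : IsClosed {x | P x}) (hu : ∀ᶠ n in l, P (u n)) : P x := by
  by_contra hx
  exact (h.frequently (hC.isOpen_compl.mem_nhds hx)) (hu.mono fun n hn hn' => hn' hn)

/-- A property that holds frequently along a selection in a compact set passes to a cluster point. -/
theorem exists_mapClusterPt_of_frequently {K : Set X} (hK : IsCompact K) {F : ℕ → Set X}
    (hFK : ∀ n, F n ⊆ K) (hne : ∀ n, (F n).Nonempty) {C : Set X} (hC : IsClosed C)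
    (h : ∃ᶠ n in atTop, (F n ∩ C).Nonempty) :
    ∃ u : ℕ → X, (∀ n, u n ∈ F n) ∧ ∃ x ∈ C, MapClusterPt x atTop u := by
  classical
  -- The selection enters `C` whenever it can, so it is in the compact set `K ∩ C` frequently.
  have hu : ∀ n, ∃ x ∈ F n, (F n ∩ C).Nonempty → x ∈ C := by
    intro n
    by_cases hn : (F n ∩ C).Nonempty
    · obtain ⟨x, hx⟩ := hn
      exact ⟨x, hx.1, fun _ => hx.2⟩
    · obtain ⟨x, hx⟩ := hne n
      exact ⟨x, hx, fun h => absurd h hn⟩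
  choose u huF huC using hu
  refine ⟨u, huF, ?_⟩
  have h1 : ∃ᶠ n in atTop, u n ∈ K ∩ C := h.mono fun n hn => ⟨hFK n (huF n), huC n hn⟩
  obtain ⟨x, hx, hux⟩ := (hK.inter_right hC).exists_mapClusterPt_of_frequently h1
  exact ⟨x, hx.2, hux⟩

/-- The lower limit gives the lower bound by following a selection to a near-maximizer; the upper
limit gives the upper bound, since near-maximizers cluster in `K`. -/
theorem tendsto_sSup_image {F : ℕ → Set X} {L K : Set X} (hK : IsCompact K) (hFK : ∀ n, F n ⊆ K)
    (hLK : L ⊆ K) (hL : L.Nonempty) (hlim : KuratowskiTendsto F L) {f : X → ℝ}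
    (hf : Continuous f) :
    Tendsto (fun n => sSup (f '' F n)) atTop (𝓝 (sSup (f '' L))) := by
  have hbdd : BddAbove (f '' K) := (hK.image hf).bddAbove
  have hne : ∀ n, (F n).Nonempty := by
    obtain ⟨x, hx⟩ := hL
    rw [hlim.1] at hx
    obtain ⟨u, hu, -⟩ := hx
    exact fun n => ⟨u n, hu n⟩
  refine tendsto_order.2 ⟨fun b hb => ?_, fun b hb => ?_⟩
  · obtain ⟨_, ⟨x, hx, rfl⟩, hbx⟩ := exists_lt_of_lt_csSup (hL.image f) hb
    rw [hlim.1] at hx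
    obtain ⟨u, hu, hux⟩ := hx
    filter_upwards [((hf.tendsto x).comp hux).eventually (lt_mem_nhds hbx)] with n hn
    exact hn.trans_le (le_csSup (hbdd.mono (Set.image_mono (hFK n))) ⟨u n, hu n, rfl⟩)
  · obtain ⟨c, hc, hcb⟩ := exists_between hb
    by_contra hcon
    have h1 : ∃ᶠ n in atTop, (F n ∩ {x | c ≤ f x}).Nonempty := by
      refine (not_eventually.1 hcon).mono fun n hn => ?_
      obtain ⟨_, ⟨x, hx, rfl⟩, hcx⟩ :=
        exists_lt_of_lt_csSup ((hne n).image f) (hcb.trans_le (not_lt.1 hn))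
      exact ⟨x, hx, hcx.le⟩
    obtain ⟨u, hu, x, hxc, hx⟩ := exists_mapClusterPt_of_frequently hK hFK hne
      (isClosed_le continuous_const hf) h1
    have hxL : x ∈ L := by
      rw [hlim.2]
      exact ⟨u, hu, hx⟩
    have h2 : f x ≤ sSup (f '' L) := le_csSup (hbdd.mono (Set.image_mono hLK)) ⟨x, hxL, rfl⟩
    have h3 : c ≤ f x := hxc
    linarith

end Kuratowski

/-! ### Feasible pairs -/

section Continuity

variable {d : ℕ}

/-- The vectors dominated by a feasible matrix, with that matrix. -/
def feasiblePairs (S : Submodule ℂ (Mat d)) :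
    Set (Matrix (Fin d × Fin d) (Fin d × Fin d) ℂ × (Fin d × Fin d → ℂ)) :=
  {z | IsFeasible S z.1 ∧ IsDominated z.1 z.2}

theorem IsFeasible.trace_eq {ι : Type*} [Fintype ι] {S : Submodule ℂ (Mat d)}
    {X : Matrix (ι × Fin d) (ι × Fin d) ℂ} (hX : IsFeasible S X) : X.trace = d := by
  have h := congrArg trace hX.sum_block
  rw [trace_sum, trace_one, Fintype.card_fin] at h
  rw [← h]
  simp [trace, Fintype.sum_prod_type]

theorem IsDominated.norm_sq_le {ι : Type*} [Fintype ι] {X : Matrix (ι × Fin d) (ι × Fin d) ℂ}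
    {a : ι × Fin d → ℂ} (ha : IsDominated X a) (x : ι × Fin d) : ‖a x‖ ^ 2 ≤ (X x x).re := by
  have h := (Complex.le_def.1 (Matrix.PosSemidef.diag_nonneg ha (i := x))).1
  rw [Matrix.sub_apply, vecMulVec_apply, Pi.star_apply, RCLike.star_def, Complex.mul_conj',
    Complex.sub_re] at h
  norm_cast at h
  simpa using h

/-- A compact set which contains all feasible pairs. -/
def pairBox (d : ℕ) : Set (Matrix (Fin d × Fin d) (Fin d × Fin d) ℂ × (Fin d × Fin d → ℂ)) :=
  {M | ∀ i j, ‖M i j‖ ≤ d} ×ˢ Metric.closedBall 0 (d + 1)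

theorem isCompact_pairBox (d : ℕ) : IsCompact (pairBox d) :=
  (isCompact_norm_apply_le _).prod (isCompact_closedBall _ _)

theorem feasiblePairs_subset_pairBox (S : Submodule ℂ (Mat d)) : feasiblePairs S ⊆ pairBox d := by
  rintro ⟨X, a⟩ ⟨hX, ha⟩
  have hXd : ∀ i j, ‖X i j‖ ≤ d := fun i j => by
    have h := PosSemidef.norm_apply_le hX.posSemidef i j
    rw [hX.trace_eq] at h
    simpa using h
  refine ⟨hXd, ?_⟩
  rw [mem_closedBall_zero_iff, pi_norm_le_iff_of_nonneg (by positivity)]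
  intro x
  have h1 := ha.norm_sq_le x
  have h2 := (Complex.re_le_norm _).trans (hXd x x)
  dsimp only at h1
  have hd : (0 : ℝ) ≤ d := Nat.cast_nonneg d
  -- The radius `d + 1` of the box is convenient because its square exceeds `d`.
  nlinarith [norm_nonneg (a x)]

/-- The maximally mixed matrix `1 / d` with the zero vector. -/
theorem feasiblePairs_nonempty {S : Submodule ℂ (Mat d)} (hS : (1 : Mat d) ∈ S) :
    (feasiblePairs S).Nonempty := by
  have hpos : (((d : ℂ)⁻¹) • (1 : Matrix (Fin d × Fin d) (Fin d × Fin d) ℂ)).PosSemidef := by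
    refine PosSemidef.one.smul ?_
    rw [← Complex.ofReal_natCast, ← Complex.ofReal_inv]
    exact Complex.zero_le_real.2 (by positivity)
  have hb : ∀ p q, block (((d : ℂ)⁻¹) • (1 : Matrix (Fin d × Fin d) (Fin d × Fin d) ℂ)) p q =
      ((d : ℂ)⁻¹ * (1 : Mat d) p q) • (1 : Mat d) := by
    intro p q
    ext i j
    simp only [block_apply, Matrix.smul_apply, one_apply, Prod.mk.injEq, smul_eq_mul]
    split_ifs <;> simp_all
  refine ⟨(((d : ℂ)⁻¹) • 1, 0), ⟨hpos, fun p q => ?_, ?_⟩, ?_⟩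
  · rw [hb]
    exact S.smul_mem _ hS
  · simp only [hb, one_apply_eq, mul_one, Finset.sum_const, Finset.card_univ, Fintype.card_fin]
    rcases Nat.eq_zero_or_pos d with rfl | hd
    · exact Subsingleton.elim _ _
    · rw [← Nat.cast_smul_eq_nsmul ℂ, smul_smul, mul_inv_cancel₀ (by positivity), one_smul]
  · simpa [IsDominated] using hpos

theorem continuous_weight {Y : Type*} [TopologicalSpace Y] {f : Y → Mat d}
    {g : Y → Fin d × Fin d → ℂ} (hf : Continuous f) (hg : Continuous g) :
    Continuous fun y => weight (f y) (g y) := by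
  unfold weight
  refine continuous_finsetSum _ fun p _ => Complex.continuous_re.comp ?_
  have h : Continuous fun y => fun i => g y (p, i) := by fun_prop
  exact (continuous_star.comp h).dotProduct (hf.matrix_mulVec h)

theorem weight_real_smul {ι : Type*} [Fintype ι] (c : ℝ) (T : Mat d) (a : ι × Fin d → ℂ) :
    weight (c • T) a = c * weight T a := by
  simp only [weight, smul_mulVec, dotProduct_smul, Complex.smul_re, smul_eq_mul, Finset.mul_sum]

theorem weight_smul_vec {ι : Type*} [Fintype ι] (c : ℝ) (T : Mat d) (a : ι × Fin d → ℂ) :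
    weight T ((c : ℂ) • a) = c ^ 2 * weight T a := by
  simp only [weight, Finset.mul_sum]
  refine Finset.sum_congr rfl fun p _ => ?_
  have h : (fun i => ((c : ℂ) • a) (p, i)) = (c : ℂ) • fun i => a (p, i) := rfl
  rw [h, mulVec_smul, dotProduct_smul, star_smul, smul_dotProduct, smul_smul, smul_eq_mul,
    RCLike.star_def, Complex.conj_ofReal, ← Complex.ofReal_mul, Complex.re_ofReal_mul, sq]

theorem continuous_block (p q : Fin d) : Continuous
    fun z : Matrix (Fin d × Fin d) (Fin d × Fin d) ℂ × (Fin d × Fin d → ℂ) => block z.1 p q :=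
  continuous_matrix fun _ _ => continuous_fst.matrix_elem _ _

/-- Positivity, normalization and domination are closed conditions, and blocks of a cluster point
are cluster points of blocks. -/
theorem setLimsup_feasiblePairs_subset {S : Submodule ℂ (Mat d)} {Sn : ℕ → Submodule ℂ (Mat d)}
    (h : setLimsup (fun n => (Sn n : Set (Mat d))) ⊆ S) :
    setLimsup (fun n => feasiblePairs (Sn n)) ⊆ feasiblePairs S := by
  rintro z ⟨u, hu, hz⟩
  refine ⟨⟨?_, fun p q => ?_, ?_⟩, ?_⟩
  · exact prop_of_mapClusterPt (fun z : Matrix (Fin d × Fin d) (Fin d × Fin d) ℂ × (Fin d × Fin d → ℂ) =>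
      z.1.PosSemidef) hz (isClosed_posSemidef.preimage continuous_fst)
      (Eventually.of_forall fun n => (hu n).1.posSemidef)
  · exact h ⟨fun n => block (u n).1 p q, fun n => (hu n).1.block_mem p q,
      hz.continuousAt_comp (continuous_block p q).continuousAt⟩
  · exact prop_of_mapClusterPt (fun z : Matrix (Fin d × Fin d) (Fin d × Fin d) ℂ × (Fin d × Fin d → ℂ) =>
      ∑ p, block z.1 p p = 1) hz
      (isClosed_eq (continuous_finsetSum _ fun p _ => continuous_block p p) continuous_const)
      (Eventually.of_forall fun n => (hu n).1.sum_block)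
  · have hc : Continuous fun z : Matrix (Fin d × Fin d) (Fin d × Fin d) ℂ × (Fin d × Fin d → ℂ) =>
        z.1 - vecMulVec z.2 (star z.2) :=
      continuous_fst.sub (continuous_snd.matrix_vecMulVec (continuous_star.comp continuous_snd))
    exact prop_of_mapClusterPt (fun z : Matrix (Fin d × Fin d) (Fin d × Fin d) ℂ × (Fin d × Fin d → ℂ) =>
      (z.1 - vecMulVec z.2 (star z.2)).PosSemidef) hz
      (isClosed_posSemidef.preimage hc)
      (Eventually.of_forall fun n => (hu n).2)

theorem mem_thCorner_iff {S : Submodule ℂ (Mat d)} {T : Mat d} :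
    T ∈ thCorner S ↔ T.PosSemidef ∧ ∀ z ∈ feasiblePairs S, weight T z.2 ≤ 1 := by
  rw [thCorner_eq_weightPolar]
  exact ⟨fun h => ⟨h.1, fun z hz => h.2 _ _ hz.1 hz.2⟩,
    fun h => ⟨h.1, fun X a hX ha => h.2 (X, a) ⟨hX, ha⟩⟩⟩

/-- Dividing `T` by its largest weight over pairs of `Sn n`, or by 1 if that is larger, puts it into
`thCorner (Sn n)`. The divisors tend to 1: otherwise violating pairs would cluster at a pair for `S`
with weight above 1. -/
theorem thCorner_subset_setLiminf {S : Submodule ℂ (Mat d)} {Sn : ℕ → Submodule ℂ (Mat d)}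
    (hSn : ∀ n, IsOperatorSystem (Sn n))
    (h : setLimsup (fun n => (Sn n : Set (Mat d))) ⊆ S) :
    thCorner S ⊆ setLiminf (fun n => thCorner (Sn n)) := by
  intro T hT
  rw [mem_thCorner_iff] at hT
  have hw : Continuous fun z : Matrix (Fin d × Fin d) (Fin d × Fin d) ℂ × (Fin d × Fin d → ℂ) =>
      weight T z.2 := continuous_weight continuous_const continuous_snd
  have hbdd : ∀ n, BddAbove ((fun z => weight T z.2) '' feasiblePairs (Sn n)) := fun n =>
    ((isCompact_pairBox d).image hw).bddAbove.mono
      (Set.image_mono (feasiblePairs_subset_pairBox _))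
  let c : ℕ → ℝ := fun n => sSup ((fun z => weight T z.2) '' feasiblePairs (Sn n))
  have hc1 : ∀ n, 0 < max 1 (c n) := fun n => lt_max_of_lt_left one_pos
  have hc : Tendsto (fun n => max 1 (c n)) atTop (𝓝 1) := by
    refine tendsto_order.2 ⟨fun b hb => Eventually.of_forall fun n => hb.trans_le (le_max_left _ _),
      fun b hb => ?_⟩
    obtain ⟨b', hb', hbb⟩ := exists_between hb
    by_contra hcon
    have h1 : ∃ᶠ n in atTop, (feasiblePairs (Sn n) ∩ {z | b' ≤ weight T z.2}).Nonempty := by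
      refine (not_eventually.1 hcon).mono fun n hn => ?_
      have h2 : b ≤ c n := by
        rcases le_max_iff.1 (not_lt.1 hn) with h | h
        · linarith
        · exact h
      obtain ⟨_, ⟨x, hx, rfl⟩, hcx⟩ := exists_lt_of_lt_csSup
        ((feasiblePairs_nonempty (hSn n).1).image _) (hbb.trans_le h2)
      exact ⟨x, hx, hcx.le⟩
    obtain ⟨u, hu, z, hzb, hz⟩ := exists_mapClusterPt_of_frequently (isCompact_pairBox d)
      (fun n => feasiblePairs_subset_pairBox (Sn n)) (fun n => feasiblePairs_nonempty (hSn n).1)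
      (isClosed_le continuous_const hw) h1
    have h3 := hT.2 z (setLimsup_feasiblePairs_subset h ⟨u, hu, hz⟩)
    have h4 : b' ≤ weight T z.2 := hzb
    linarith
  refine ⟨fun n => (max 1 (c n))⁻¹ • T, fun n => ?_, ?_⟩
  · change (max 1 (c n))⁻¹ • T ∈ thCorner (Sn n)
    rw [mem_thCorner_iff]
    refine ⟨hT.1.smul (inv_nonneg.2 (hc1 n).le), fun z hz => ?_⟩
    rw [weight_real_smul, inv_mul_le_iff₀ (hc1 n), mul_one]
    exact (le_csSup (hbdd n) ⟨z, hz, rfl⟩).trans (le_max_right _ _)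
  · have := (hc.inv₀ one_ne_zero).smul_const T
    simpa using this

/-! ### Perturbing a feasible pair into nearby operator systems -/

theorem eventually_posSemidef_smul_one_add {n : Type*} [Fintype n] [DecidableEq n] {c : ℝ}
    (hc : 0 < c) {D : ℕ → Matrix n n ℂ} (hD : ∀ k, (D k).IsHermitian)
    (hlim : Tendsto D atTop (𝓝 0)) :
    ∀ᶠ k in atTop, ((c : ℂ) • (1 : Matrix n n ℂ) + D k).PosSemidef := by
  obtain ⟨N, hN⟩ : ∃ N : ℝ, N = (Fintype.card n : ℝ) := ⟨_, rfl⟩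
  have hN0 : 0 ≤ N := hN ▸ Nat.cast_nonneg _
  -- Entries of size `δ` change the quadratic form by at most `δ * N * ‖v‖²`. Using `N + 1` also
  -- covers an empty index type.
  have hδ : 0 < c / (N + 1) := by positivity
  have h1 : ∀ᶠ k in atTop, ∀ i j, ‖D k i j‖ < c / (N + 1) := by
    refine eventually_all.2 fun i => eventually_all.2 fun j => ?_
    have h2 : Tendsto (fun k => ‖D k i j‖) atTop (𝓝 0) := by
      have h3 : Continuous fun M : Matrix n n ℂ => ‖M i j‖ :=
        continuous_norm.comp (continuous_id.matrix_elem i j)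
      have h4 := (h3.tendsto 0).comp hlim
      rwa [Matrix.zero_apply, norm_zero] at h4
    exact h2.eventually (gt_mem_nhds hδ)
  filter_upwards [h1] with k hk
  rw [posSemidef_iff_re]
  refine ⟨(isHermitian_one.smul (Complex.conj_ofReal c)).add (hD k), fun v => ?_⟩
  have h4 : ‖star v ⬝ᵥ (D k *ᵥ v)‖ ≤ c / (N + 1) * (N * ∑ i, ‖v i‖ ^ 2) := by
    calc ‖star v ⬝ᵥ (D k *ᵥ v)‖ ≤ ∑ i, ∑ j, c / (N + 1) * ((‖v i‖ ^ 2 + ‖v j‖ ^ 2) / 2) := by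
          rw [dotProduct]
          refine (norm_sum_le _ _).trans (Finset.sum_le_sum fun i _ => ?_)
          rw [mulVec, dotProduct, Finset.mul_sum]
          refine (norm_sum_le _ _).trans (Finset.sum_le_sum fun j _ => ?_)
          rw [norm_mul, norm_mul, Pi.star_apply, norm_star]
          have h5 := (hk i j).le
          calc ‖v i‖ * (‖D k i j‖ * ‖v j‖) = ‖D k i j‖ * (‖v i‖ * ‖v j‖) := by ring
            _ ≤ c / (N + 1) * ((‖v i‖ ^ 2 + ‖v j‖ ^ 2) / 2) := by
              refine mul_le_mul h5 ?_ (by positivity) hδ.le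
              nlinarith [sq_nonneg (‖v i‖ - ‖v j‖)]
      _ = c / (N + 1) * (N * ∑ i, ‖v i‖ ^ 2) := by
          simp only [← Finset.mul_sum, ← Finset.sum_div, Finset.sum_add_distrib, Finset.sum_const,
            Finset.card_univ, nsmul_eq_mul, ← hN]
          ring
  rw [add_mulVec, smul_mulVec, one_mulVec, dotProduct_add, dotProduct_smul, Complex.add_re,
    smul_eq_mul, Complex.re_ofReal_mul, star_dotProduct_self_re]
  have h6 := (abs_le.1 ((Complex.abs_re_le_norm _).trans h4)).1
  have h7 : c / (N + 1) * (N * ∑ i, ‖v i‖ ^ 2) ≤ c * ∑ i, ‖v i‖ ^ 2 := by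
    rw [← mul_assoc]
    refine mul_le_mul_of_nonneg_right ?_ (by positivity)
    rw [div_mul_eq_mul_div, div_le_iff₀ (by positivity)]
    nlinarith
  linarith

/-- The block matrix with given blocks. -/
def ofBlocks {ι : Type*} (f : ι → ι → Mat d) : Matrix (ι × Fin d) (ι × Fin d) ℂ :=
  of fun x y => f x.1 y.1 x.2 y.2

theorem block_conjTranspose {ι : Type*} (X : Matrix (ι × Fin d) (ι × Fin d) ℂ) (p q : ι) :
    block Xᴴ p q = (block X q p)ᴴ := rfl

/-- The error in the normalization of the hermitian part. -/
noncomputable def blockDefect (u : Fin d → Fin d → Mat d) : Mat d :=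
  ∑ p, (2⁻¹ : ℂ) • (u p p + (u p p)ᴴ) - 1

/-- Hermitian part, mixed with the maximally mixed state and normalized. -/
noncomputable def mixBlocks (c : ℝ) (u : Fin d → Fin d → Mat d) (p q : Fin d) : Mat d :=
  ((c ^ 2 : ℝ) : ℂ) • (2⁻¹ : ℂ) • (u p q + (u q p)ᴴ) +
    (1 : Mat d) p q • ((((1 - c ^ 2) / d : ℝ) : ℂ) • (1 : Mat d) -
      ((c ^ 2 / d : ℝ) : ℂ) • blockDefect u)

theorem continuous_mixBlocks (c : ℝ) :
    Continuous fun u : Fin d → Fin d → Mat d => ofBlocks (mixBlocks c u) := by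
  refine continuous_matrix fun x y => ?_
  unfold ofBlocks mixBlocks blockDefect
  have h : Continuous fun u : Fin d → Fin d → Mat d => ((c ^ 2 : ℝ) : ℂ) • (2⁻¹ : ℂ) •
      (u x.1 y.1 + (u y.1 x.1)ᴴ) + (1 : Mat d) x.1 y.1 • ((((1 - c ^ 2) / d : ℝ) : ℂ) • (1 : Mat d) -
      ((c ^ 2 / d : ℝ) : ℂ) • (∑ p, (2⁻¹ : ℂ) • (u p p + (u p p)ᴴ) - 1)) := by
    fun_prop
  exact h.matrix_elem x.2 y.2

theorem mixBlocks_mem {S : Submodule ℂ (Mat d)} (hS : IsOperatorSystem S) (c : ℝ)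
    {u : Fin d → Fin d → Mat d} (hu : ∀ p q, u p q ∈ S) (p q : Fin d) : mixBlocks c u p q ∈ S := by
  have h : ∀ p q, u p q + (u q p)ᴴ ∈ S := fun p q => S.add_mem (hu p q) (hS.2 _ (hu q p))
  refine S.add_mem (S.smul_mem _ (S.smul_mem _ (h p q))) (S.smul_mem _ (S.sub_mem
    (S.smul_mem _ hS.1) (S.smul_mem _ (S.sub_mem (S.sum_mem fun p _ => S.smul_mem _ (h p p)) hS.1))))

theorem isHermitian_mixBlocks (c : ℝ) (u : Fin d → Fin d → Mat d) :
    (ofBlocks (mixBlocks c u)).IsHermitian := by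
  have hE : (blockDefect u)ᴴ = blockDefect u := by
    simp [blockDefect, conjTranspose_sum, add_comm]
  have h : ∀ p q, (mixBlocks c u q p)ᴴ = mixBlocks c u p q := by
    intro p q
    simp only [mixBlocks, conjTranspose_add, conjTranspose_smul, conjTranspose_sub, hE,
      conjTranspose_conjTranspose, conjTranspose_one, RCLike.star_def, Complex.conj_ofReal,
      one_apply, eq_comm (a := q), add_comm (u p q)]
    congr 2
    · simp [show (starRingEnd ℂ) 2 = 2 from Complex.conj_ofNat 2]
    · split_ifs <;> simp
  ext ⟨p, i⟩ ⟨q, j⟩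
  exact congrArg (fun M : Mat d => M i j) (h p q)

/-- Each of the `d` diagonal blocks absorbs an equal share of the defect, hence `d ≠ 0`. -/
theorem sum_mixBlocks (hd : d ≠ 0) (c : ℝ) (u : Fin d → Fin d → Mat d) :
    ∑ p, mixBlocks c u p p = 1 := by
  have hd' : (d : ℂ) ≠ 0 := by exact_mod_cast hd
  have h : ∑ p, (2⁻¹ : ℂ) • (u p p + (u p p)ᴴ) = blockDefect u + 1 := by simp [blockDefect]
  simp only [mixBlocks, one_apply_eq, one_smul]
  rw [Finset.sum_add_distrib, ← Finset.smul_sum, h, Finset.sum_const, Finset.card_univ,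
    Fintype.card_fin, ← Nat.cast_smul_eq_nsmul ℂ, smul_sub, smul_smul, smul_smul]
  push_cast
  rw [mul_div_cancel₀ _ hd', mul_div_cancel₀ _ hd']
  module

/-- On a feasible matrix the hermitian part is the matrix itself and the defect vanishes; this
identifies the limit of the perturbed matrices. -/
theorem mixBlocks_block {S : Submodule ℂ (Mat d)} {X : Matrix (Fin d × Fin d) (Fin d × Fin d) ℂ}
    (hX : IsFeasible S X) (c : ℝ) :
    ofBlocks (mixBlocks c (block X)) =
      ((c ^ 2 : ℝ) : ℂ) • X + (((1 - c ^ 2) / d : ℝ) : ℂ) • 1 := by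
  have hb : ∀ p q, (2⁻¹ : ℂ) • (block X p q + (block X q p)ᴴ) = block X p q := by
    intro p q
    rw [← block_conjTranspose, hX.posSemidef.1.eq, ← two_smul ℂ, smul_smul]
    norm_num
  have hE : blockDefect (block X) = 0 := by
    simp only [blockDefect, hb, hX.sum_block, sub_self]
  ext ⟨p, i⟩ ⟨q, j⟩
  simp only [ofBlocks, mixBlocks, hb, hE, of_apply, smul_zero, sub_zero, Matrix.add_apply,
    Matrix.smul_apply, block_apply, one_apply, Prod.mk.injEq, ite_and]
  split_ifs <;> simp

theorem eventually_exists_feasible {S : Submodule ℂ (Mat d)} {Sn : ℕ → Submodule ℂ (Mat d)}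
    (hd : d ≠ 0) (hSn : ∀ n, IsOperatorSystem (Sn n))
    (h : (S : Set (Mat d)) ⊆ setLiminf (fun n => (Sn n : Set (Mat d))))
    {z : Matrix (Fin d × Fin d) (Fin d × Fin d) ℂ × (Fin d × Fin d → ℂ)}
    (hz : z ∈ feasiblePairs S) {c : ℝ} (hc : c ^ 2 < 1) :
    ∀ᶠ n in atTop, ∃ X, (X, (c : ℂ) • z.2) ∈ feasiblePairs (Sn n) := by
  have hu : ∀ p q, ∃ u : ℕ → Mat d, (∀ n, u n ∈ Sn n) ∧ Tendsto u atTop (𝓝 (block z.1 p q)) :=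
    fun p q => h (hz.1.block_mem p q)
  choose u huS hu using hu
  let X : ℕ → Matrix (Fin d × Fin d) (Fin d × Fin d) ℂ := fun n =>
    ofBlocks (mixBlocks c fun p q => u p q n)
  let e : ℝ := (1 - c ^ 2) / d
  have he : 0 < e := div_pos (by linarith) (by positivity)
  have hX : Tendsto X atTop (𝓝 (((c ^ 2 : ℝ) : ℂ) • z.1 + (e : ℂ) • 1)) := by
    rw [← mixBlocks_block hz.1 c]
    exact ((continuous_mixBlocks c).tendsto _).comp
      (tendsto_pi_nhds.2 fun p => tendsto_pi_nhds.2 fun q => hu p q)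
  let D : ℕ → Matrix (Fin d × Fin d) (Fin d × Fin d) ℂ := fun n =>
    X n - (((c ^ 2 : ℝ) : ℂ) • z.1 + (e : ℂ) • 1)
  have hD : Tendsto D atTop (𝓝 0) := by
    have := hX.sub_const (((c ^ 2 : ℝ) : ℂ) • z.1 + (e : ℂ) • 1)
    rwa [sub_self] at this
  have hDh : ∀ n, (D n).IsHermitian := fun n => (isHermitian_mixBlocks _ _).sub
    ((hz.1.posSemidef.1.smul (Complex.conj_ofReal _)).add
      (isHermitian_one.smul (Complex.conj_ofReal _)))
  filter_upwards [eventually_posSemidef_smul_one_add he hDh hD] with n hn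
  -- With `X` and `a` the parts of `z`, `X n - c² a a* = c² (X - a a*) + (e • 1 + D n)`: the mixing
  -- term pays for the error. Positivity of `X n` itself then follows.
  have hdom : IsDominated (X n) ((c : ℂ) • z.2) := by
    have h1 : (0 : ℂ) ≤ ((c ^ 2 : ℝ) : ℂ) := Complex.zero_le_real.2 (by positivity)
    have h2 := (Matrix.PosSemidef.smul hz.2 h1).add hn
    have h3 : vecMulVec ((c : ℂ) • z.2) (star ((c : ℂ) • z.2)) =
        ((c ^ 2 : ℝ) : ℂ) • vecMulVec z.2 (star z.2) := by
      rw [star_smul, smul_vecMulVec, vecMulVec_smul, smul_smul, RCLike.star_def,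
        Complex.conj_ofReal]
      push_cast
      rw [sq]
    rw [IsDominated, h3]
    convert h2 using 1
    simp only [D, smul_sub]
    abel
  refine ⟨X n, ⟨?_, fun p q => ?_, ?_⟩, hdom⟩
  · have := Matrix.PosSemidef.add hdom (posSemidef_vecMulVec_self_star ((c : ℂ) • z.2))
    rwa [sub_add_cancel] at this
  · exact mixBlocks_mem (hSn n) c (fun p q => huS p q n) p q
  · exact sum_mixBlocks hd c fun p q => u p q n

theorem setLimsup_thCorner_subset {S : Submodule ℂ (Mat d)} {Sn : ℕ → Submodule ℂ (Mat d)}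
    (hSn : ∀ n, IsOperatorSystem (Sn n))
    (h : (S : Set (Mat d)) ⊆ setLiminf (fun n => (Sn n : Set (Mat d)))) :
    setLimsup (fun n => thCorner (Sn n)) ⊆ thCorner S := by
  rintro T ⟨u, hu', hT⟩
  have hu : ∀ n, u n ∈ thCorner (Sn n) := hu'
  rw [mem_thCorner_iff]
  refine ⟨prop_of_mapClusterPt (fun T : Mat d => T.PosSemidef) hT isClosed_posSemidef (Eventually.of_forall fun n => (hu n).1),
    fun z hz => ?_⟩
  rcases eq_or_ne d 0 with rfl | hd
  · simp [weight]
  -- Only shrunken vectors `c a` are reached by pairs of `Sn n`; `c → 1` at the end.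
  have key : ∀ c : ℝ, c ∈ Set.Ico (0 : ℝ) 1 → c ^ 2 * weight T z.2 ≤ 1 := by
    rintro c ⟨hc0, hc1⟩
    have hw : Continuous fun T : Mat d => c ^ 2 * weight T z.2 :=
      continuous_const.mul (continuous_weight continuous_id continuous_const)
    refine prop_of_mapClusterPt (fun T : Mat d => c ^ 2 * weight T z.2 ≤ 1) hT
      (isClosed_le hw continuous_const) ?_
    filter_upwards [eventually_exists_feasible hd hSn h hz (c := c) (by nlinarith)] with n hn
    obtain ⟨X, hX⟩ := hn
    have h1 := (mem_thCorner_iff.1 (hu n)).2 (X, (c : ℂ) • z.2) hX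
    rwa [weight_smul_vec] at h1
  have hlim : Tendsto (fun c : ℝ => c ^ 2 * weight T z.2) (𝓝[<] 1) (𝓝 (1 ^ 2 * weight T z.2)) :=
    ((continuous_pow 2).mul continuous_const).continuousWithinAt
  have := le_of_tendsto hlim (mem_of_superset (Ico_mem_nhdsLT (zero_lt_one' ℝ)) key)
  simpa using this

theorem zero_mem_thCorner (S : Submodule ℂ (Mat d)) : (0 : Mat d) ∈ thCorner S :=
  ⟨PosSemidef.zero, fun k Φ _ => by rw [map_zero, sub_zero]; exact PosSemidef.one⟩

/-- The identity channel has graph `ℂ 1`, contained in `S`. -/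
theorem one_sub_posSemidef_of_mem_thCorner {S : Submodule ℂ (Mat d)} (hS : (1 : Mat d) ∈ S)
    {T : Mat d} (hT : T ∈ thCorner S) : (1 - T).PosSemidef := by
  have h := hT.2 d (krausMap fun _ : Fin 1 => 1)
    ((mem_channelsInto_iff (isKraus_krausMap _)).2 ⟨by simp, fun p q => by simpa using hS⟩)
  simpa [krausMap] using h

theorem trace_re_le_of_mem_thCorner {S : Submodule ℂ (Mat d)} (hS : (1 : Mat d) ∈ S)
    {T : Mat d} (hT : T ∈ thCorner S) : T.trace.re ≤ d := by
  have h := (Complex.le_def.1 (one_sub_posSemidef_of_mem_thCorner hS hT).trace_nonneg).1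
  rw [trace_sub, trace_one, Complex.sub_re] at h
  simp at h
  linarith

theorem thCorner_subset_box {S : Submodule ℂ (Mat d)} (hS : (1 : Mat d) ∈ S) :
    thCorner S ⊆ {M | ∀ i j, ‖M i j‖ ≤ d} := fun _ hT i j =>
  (PosSemidef.norm_apply_le hT.1 i j).trans (trace_re_le_of_mem_thCorner hS hT)

theorem continuous_trace_re : Continuous fun T : Mat d => T.trace.re :=
  Complex.continuous_re.comp continuous_id.matrix_trace

theorem kuratowskiTendsto_thCorner {S : Submodule ℂ (Mat d)} {Sn : ℕ → Submodule ℂ (Mat d)}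
    (hSn : ∀ n, IsOperatorSystem (Sn n))
    (h : KuratowskiTendsto (fun n => (Sn n : Set (Mat d))) (S : Set (Mat d))) :
    KuratowskiTendsto (fun n => thCorner (Sn n)) (thCorner S) :=
  kuratowskiTendsto_of_subset (thCorner_subset_setLiminf hSn h.2.symm.subset)
    (setLimsup_thCorner_subset hSn h.1.subset)

theorem tendsto_lovaszTheta {S : Submodule ℂ (Mat d)} {Sn : ℕ → Submodule ℂ (Mat d)}
    (hS : IsOperatorSystem S) (hSn : ∀ n, IsOperatorSystem (Sn n))
    (h : KuratowskiTendsto (fun n => (Sn n : Set (Mat d))) (S : Set (Mat d))) :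
    Tendsto (fun n => lovaszTheta (Sn n)) atTop (𝓝 (lovaszTheta S)) :=
  tendsto_sSup_image (isCompact_norm_apply_le (d : ℝ)) (fun n => thCorner_subset_box (hSn n).1)
    (thCorner_subset_box hS.1) ⟨0, zero_mem_thCorner S⟩ (kuratowskiTendsto_thCorner hSn h)
    continuous_trace_re

end Continuity

/-! ### Orthogonal complements of traceless hermitian matrices -/

section Hyperplanes

variable {d : ℕ}

instance firstCountableTopology_matrix {m n : Type*} [Countable m] [Countable n] :
    FirstCountableTopology (Matrix m n ℂ) :=
  inferInstanceAs (FirstCountableTopology (m → n → ℂ))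

theorem mem_hsOrthogonal_singleton {L A : Mat d} :
    A ∈ hsOrthogonal {L} ↔ (Lᴴ * A).trace = 0 :=
  ⟨fun h => h L rfl, fun h B hB => by rwa [Set.mem_singleton_iff.1 hB]⟩

theorem hsOrthogonal_smul {c : ℝ} (hc : c ≠ 0) (L : Mat d) :
    hsOrthogonal {c • L} = hsOrthogonal {L} := by
  ext A
  rw [mem_hsOrthogonal_singleton, mem_hsOrthogonal_singleton, conjTranspose_smul, Matrix.smul_mul,
    trace_smul]
  simp [hc]

theorem kuratowskiTendsto_hsOrthogonal {L : Mat d} {Ln : ℕ → Mat d} (hL : L ≠ 0)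
    (hLn : ∀ n, Ln n ≠ 0) (h : Tendsto Ln atTop (𝓝 L)) :
    KuratowskiTendsto (fun n => (hsOrthogonal {Ln n} : Set (Mat d)))
      (hsOrthogonal {L} : Set (Mat d)) := by
  have hct : Continuous fun z : Mat d × Mat d => (z.1ᴴ * z.2).trace :=
    (continuous_fst.matrix_conjTranspose.matrix_mul continuous_snd).matrix_trace
  refine kuratowskiTendsto_of_subset ?_ ?_
  · intro A hA
    have hA' := mem_hsOrthogonal_singleton.1 hA
    -- The orthogonal projection of `A` off `Ln n`; the correction tends to zero because `A` is
    -- orthogonal to `L ≠ 0`.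
    refine ⟨fun n => A - (((Ln n)ᴴ * A).trace / ((Ln n)ᴴ * Ln n).trace) • Ln n, fun n => ?_, ?_⟩
    · refine mem_hsOrthogonal_singleton.2 ?_
      have h1 : ((Ln n)ᴴ * Ln n).trace ≠ 0 := fun h0 =>
        hLn n (trace_conjTranspose_mul_self_eq_zero_iff.1 h0)
      rw [Matrix.mul_sub, trace_sub, Matrix.mul_smul, trace_smul, smul_eq_mul,
        div_mul_cancel₀ _ h1, sub_self]
    · have h1 : (Lᴴ * L).trace ≠ 0 := fun h0 =>
        hL (trace_conjTranspose_mul_self_eq_zero_iff.1 h0)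
      have h2 := (hct.tendsto (L, A)).comp (h.prodMk_nhds (tendsto_const_nhds (x := A)))
      have h3 := (hct.tendsto (L, L)).comp (h.prodMk_nhds h)
      have h4 := (tendsto_const_nhds (x := A)).sub ((h2.div h3 h1).smul h)
      simp only [hA', zero_div, zero_smul, sub_zero] at h4
      exact h4
  · rintro A ⟨u, hu, hA⟩
    obtain ⟨U, hU, hUA⟩ := mapClusterPt_iff_ultrafilter.1 hA
    refine mem_hsOrthogonal_singleton.2 ?_
    have h2 := (hct.tendsto (L, A)).comp ((h.mono_left hU).prodMk_nhds hUA)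
    refine tendsto_nhds_unique h2 ?_
    have h3 : ((fun z : Mat d × Mat d => (z.1ᴴ * z.2).trace) ∘ fun n => (Ln n, u n)) =
        fun _ => 0 := funext fun n => mem_hsOrthogonal_singleton.1 (hu n)
    rw [h3]
    exact tendsto_const_nhds

theorem continuousOn_lovaszTheta_hsOrthogonal :
    ContinuousOn (fun L : Mat d => lovaszTheta (hsOrthogonal {L})) (tracelessHermitian d) := by
  rw [continuousOn_iff_continuous_domRestrict, continuous_iff_seqContinuous]
  intro u L hu
  exact tendsto_lovaszTheta (isOperatorSystem_hsOrthogonal L.2)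
    (fun n => isOperatorSystem_hsOrthogonal (u n).2)
    (kuratowskiTendsto_hsOrthogonal L.2.2.2 (fun n => (u n).2.2.2)
      ((continuous_subtype_val.tendsto L).comp hu))

/-- The real space of hermitian matrices of trace zero. -/
def tracelessSubmodule (d : ℕ) : Submodule ℝ (Mat d) where
  carrier := {A | A.IsHermitian ∧ A.trace = 0}
  add_mem' hA hB := ⟨hA.1.add hB.1, by rw [trace_add, hA.2, hB.2, add_zero]⟩
  zero_mem' := ⟨isHermitian_zero, trace_zero _ _⟩
  smul_mem' c A hA := ⟨by
    rw [IsHermitian, conjTranspose_smul, hA.1.eq, star_trivial], by rw [trace_smul, hA.2, smul_zero]⟩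

theorem tracelessHermitian_eq_image (d : ℕ) :
    tracelessHermitian d = Subtype.val '' ({0}ᶜ : Set (tracelessSubmodule d)) := by
  ext A
  constructor
  · rintro ⟨h1, h2, h3⟩
    exact ⟨⟨A, h1, h2⟩, fun h => h3 (congrArg Subtype.val h), rfl⟩
  · rintro ⟨⟨B, h1, h2⟩, hB, rfl⟩
    exact ⟨h1, h2, fun h => hB (Subtype.ext h)⟩

theorem single_sub_single_mem {i j : Fin d} (hij : i ≠ j) :
    (Matrix.single i i 1 - Matrix.single j j 1 : Mat d) ∈ tracelessHermitian d := by
  refine ⟨?_, by simp, fun h => ?_⟩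
  · simp [IsHermitian]
  · have := congrArg (fun M : Mat d => M i i) h
    simp [hij.symm] at this

theorem one_lt_rank_tracelessSubmodule (hd : 2 ≤ d) :
    1 < Module.rank ℝ (tracelessSubmodule d) := by
  let i : Fin d := ⟨0, by omega⟩
  let j : Fin d := ⟨1, by omega⟩
  have hij : i ≠ j := by simp [i, j]
  have h1 := single_sub_single_mem hij
  let A : tracelessSubmodule d := ⟨Matrix.single i i 1 - Matrix.single j j 1, h1.1, h1.2.1⟩
  let B : tracelessSubmodule d := ⟨Matrix.single i j 1 + Matrix.single j i 1, by
    simp [IsHermitian, add_comm], by simp [hij, hij.symm]⟩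
  have hli : LinearIndependent ℝ ![A, B] := by
    rw [LinearIndependent.pair_iff]
    intro s t hst
    have hst' : s • (Matrix.single i i 1 - Matrix.single j j 1 : Mat d) +
        t • (Matrix.single i j 1 + Matrix.single j i 1 : Mat d) = 0 := congrArg Subtype.val hst
    have e1 := congrArg (fun M : Mat d => M i i) hst'
    have e2 := congrArg (fun M : Mat d => M i j) hst'
    simp [hij, hij.symm] at e1 e2
    exact ⟨e1, e2⟩
  have := hli.cardinal_le_rank
  rw [Cardinal.mk_fin] at this
  exact lt_of_lt_of_le (by norm_num) this

theorem isConnected_tracelessHermitian (hd : 2 ≤ d) : IsConnected (tracelessHermitian d) := by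
  rw [tracelessHermitian_eq_image]
  exact (isConnected_compl_singleton_of_one_lt_rank (one_lt_rank_tracelessSubmodule hd) 0).image _
    continuous_subtype_val.continuousOn

/-- The traceless hermitian matrices of Hilbert–Schmidt norm one. -/
def tracelessSphere (d : ℕ) : Set (Mat d) :=
  {L | L ∈ tracelessHermitian d ∧ ∑ i, ∑ j, ‖L i j‖ ^ 2 = 1}

theorem continuous_sum_norm_sq : Continuous fun L : Mat d => ∑ i, ∑ j, ‖L i j‖ ^ 2 :=
  continuous_finsetSum _ fun i _ => continuous_finsetSum _ fun j _ =>
    (continuous_norm.comp (continuous_id.matrix_elem i j)).pow 2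

theorem isCompact_tracelessSphere (d : ℕ) : IsCompact (tracelessSphere d) := by
  refine (isCompact_norm_apply_le (1 : ℝ)).of_isClosed_subset ?_ ?_
  · have h : tracelessSphere d =
        ({L | Lᴴ = L} ∩ {L | L.trace = 0}) ∩ {L | ∑ i, ∑ j, ‖L i j‖ ^ 2 = 1} := by
      ext L
      constructor
      · exact fun h => ⟨⟨h.1.1, h.1.2.1⟩, h.2⟩
      · rintro ⟨⟨h1, h2⟩, h3⟩
        refine ⟨⟨h1, h2, ?_⟩, h3⟩
        rintro rfl
        have h4 : ∑ i : Fin d, ∑ j : Fin d, ‖(0 : Mat d) i j‖ ^ 2 = 1 := h3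
        simp at h4
    rw [h]
    exact ((isClosed_eq continuous_id.matrix_conjTranspose continuous_id).inter
      (isClosed_eq continuous_id.matrix_trace continuous_const)).inter
      (isClosed_eq continuous_sum_norm_sq continuous_const)
  · rintro L ⟨-, hL⟩ i j
    have h1 : ‖L i j‖ ^ 2 ≤ 1 := by
      rw [← hL]
      exact (Finset.single_le_sum (f := fun j => ‖L i j‖ ^ 2) (fun _ _ => by positivity)
        (Finset.mem_univ j)).trans (Finset.single_le_sum (f := fun i => ∑ j, ‖L i j‖ ^ 2)
        (fun _ _ => by positivity) (Finset.mem_univ i))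
    nlinarith [norm_nonneg (L i j)]

/-- The complement is unchanged by nonzero real scaling, so the compact unit sphere already gives
all values. -/
theorem image_tracelessHermitian_eq (d : ℕ) :
    (fun L : Mat d => lovaszTheta (hsOrthogonal {L})) '' tracelessHermitian d =
      (fun L : Mat d => lovaszTheta (hsOrthogonal {L})) '' tracelessSphere d := by
  refine Set.Subset.antisymm ?_ (Set.image_mono fun L hL => hL.1)
  rintro _ ⟨L, hL, rfl⟩
  set s := ∑ i, ∑ j, ‖L i j‖ ^ 2 with hs
  have h0 : 0 < s := by
    refine lt_of_le_of_ne (by positivity) fun h => hL.2.2 ?_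
    ext i j
    have h1 := (Finset.sum_eq_zero_iff_of_nonneg fun i _ => by positivity).1 h.symm i
      (Finset.mem_univ i)
    have h2 := (Finset.sum_eq_zero_iff_of_nonneg fun j _ => by positivity).1 h1 j
      (Finset.mem_univ j)
    simpa using h2
  have hc : (Real.sqrt s)⁻¹ ≠ 0 := by positivity
  refine ⟨(Real.sqrt s)⁻¹ • L, ⟨⟨?_, ?_, smul_ne_zero hc hL.2.2⟩, ?_⟩, ?_⟩
  · rw [IsHermitian, conjTranspose_smul, hL.1.eq, star_trivial]
  · rw [trace_smul, hL.2.1, smul_zero]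
  · simp only [Matrix.smul_apply, norm_smul, mul_pow, ← Finset.mul_sum, ← hs]
    rw [norm_inv, Real.norm_of_nonneg (Real.sqrt_nonneg _), inv_pow, Real.sq_sqrt h0.le,
      inv_mul_cancel₀ h0.ne']
  · simp only [hsOrthogonal_smul hc]

theorem image_lovaszTheta_hsOrthogonal_eq_Icc (hd : 2 ≤ d) :
    (fun L : Mat d => lovaszTheta (hsOrthogonal {L})) '' tracelessHermitian d =
      Set.Icc (sInf ((fun L : Mat d => lovaszTheta (hsOrthogonal {L})) '' tracelessHermitian d))
        (sSup ((fun L : Mat d => lovaszTheta (hsOrthogonal {L})) '' tracelessHermitian d)) := by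
  refine eq_Icc_of_connected_compact
    ((isConnected_tracelessHermitian hd).image _ continuousOn_lovaszTheta_hsOrthogonal) ?_
  rw [image_tracelessHermitian_eq]
  exact (isCompact_tracelessSphere d).image_of_continuousOn
    (continuousOn_lovaszTheta_hsOrthogonal.mono fun L hL => hL.1)

end Hyperplanes

/-! ### Bounds for the Lovász number -/

section Bounds

variable {d m : ℕ}

theorem bddAbove_trace_thCorner {S : Submodule ℂ (Mat d)} (hS : (1 : Mat d) ∈ S) :
    BddAbove ((fun T : Mat d => T.trace.re) '' thCorner S) :=
  ⟨d, by rintro _ ⟨T, hT, rfl⟩; exact trace_re_le_of_mem_thCorner hS hT⟩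

theorem trace_re_le_lovaszTheta {S : Submodule ℂ (Mat d)} (hS : (1 : Mat d) ∈ S) {T : Mat d}
    (hT : T ∈ thCorner S) : T.trace.re ≤ lovaszTheta S :=
  le_csSup (bddAbove_trace_thCorner hS) ⟨T, hT, rfl⟩

theorem lovaszTheta_le {S : Submodule ℂ (Mat d)} {c : ℝ}
    (h : ∀ T ∈ thCorner S, T.trace.re ≤ c) : lovaszTheta S ≤ c :=
  csSup_le ⟨_, 0, zero_mem_thCorner S, rfl⟩ (by rintro _ ⟨T, hT, rfl⟩; exact h T hT)

theorem weight_one {ι : Type*} [Fintype ι] (a : ι × Fin d → ℂ) :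
    weight (1 : Mat d) a = ∑ x, ‖a x‖ ^ 2 := by
  simp only [weight, one_mulVec, star_dotProduct_self_re, Fintype.sum_prod_type]

/-- Closedness is the upper limit inclusion for the constant sequence `S`. -/
theorem isCompact_feasiblePairs (S : Submodule ℂ (Mat d)) : IsCompact (feasiblePairs S) := by
  refine (isCompact_pairBox d).of_isClosed_subset ?_ (feasiblePairs_subset_pairBox S)
  refine isClosed_of_closure_subset fun z hz => ?_
  obtain ⟨u, hu, huz⟩ := mem_closure_iff_seq_limit.1 hz
  refine setLimsup_feasiblePairs_subset (S := S) (Sn := fun _ => S) ?_ ⟨u, hu, huz.mapClusterPt⟩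
  rintro A ⟨v, hv, hA⟩
  exact prop_of_mapClusterPt (fun A => A ∈ S) hA (Submodule.closed_of_finiteDimensional S)
    (Eventually.of_forall hv)

theorem trace_vecMulVec_star {n : Type*} [Fintype n] (a : n → ℂ) :
    (vecMulVec a (star a)).trace = ((∑ x, ‖a x‖ ^ 2 : ℝ) : ℂ) := by
  rw [trace_vecMulVec, dotProduct_comm, star_dotProduct_self]

/-- The blocks are `u_p u_q*`, where the `u_p` are the columns of a square `U` with `U * Uᴴ = 1`.
Such a `U` is unitary, so these products span all matrices. -/
theorem eq_top_of_rank_one {S : Submodule ℂ (Mat d)} {a : Fin d × Fin d → ℂ}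
    (hX : IsFeasible S (vecMulVec a (star a))) : S = ⊤ := by
  rw [eq_top_iff]
  intro M _
  let U : Mat d := of fun i p => a (p, i)
  have hb : ∀ p q i j, block (vecMulVec a (star a)) p q i j = U i p * star (U j q) :=
    fun p q i j => rfl
  have hU : U * Uᴴ = 1 := by
    rw [← hX.sum_block]
    ext i j
    simp only [Matrix.sum_apply, mul_apply, hb, conjTranspose_apply]
  have hM : M = ∑ p, ∑ q, (Uᴴ * M * U) p q • block (vecMulVec a (star a)) p q := by
    have h1 : M = U * (Uᴴ * M * U) * Uᴴ := by
      calc M = (U * Uᴴ) * M * (U * Uᴴ) := by rw [hU, Matrix.one_mul, Matrix.mul_one]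
        _ = _ := by simp only [Matrix.mul_assoc]
    generalize Uᴴ * M * U = N at h1 ⊢
    rw [h1]
    ext i j
    simp only [Matrix.sum_apply, Matrix.smul_apply, hb, mul_apply, smul_eq_mul,
      conjTranspose_apply, Finset.sum_mul]
    rw [Finset.sum_comm]
    refine Finset.sum_congr rfl fun p _ => Finset.sum_congr rfl fun q _ => ?_
    ring
  rw [hM]
  exact S.sum_mem fun p _ => S.sum_mem fun q _ => S.smul_mem _ (hX.block_mem p q)

/-- The trace of `X` is `d` and that of `a a*` is the weight of the identity, so equality forces `X
= a a*`. -/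
theorem weight_one_lt {S : Submodule ℂ (Mat d)} (hS : S ≠ ⊤)
    {z : Matrix (Fin d × Fin d) (Fin d × Fin d) ℂ × (Fin d × Fin d → ℂ)}
    (hz : z ∈ feasiblePairs S) : weight 1 z.2 < d := by
  have htr : (z.1 - vecMulVec z.2 (star z.2)).trace = ((d - weight 1 z.2 : ℝ) : ℂ) := by
    rw [trace_sub, hz.1.trace_eq, trace_vecMulVec_star, weight_one]
    push_cast
    rfl
  have h0 := Matrix.PosSemidef.trace_nonneg hz.2
  rw [htr, Complex.zero_le_real] at h0
  refine lt_of_le_of_ne (by linarith) fun h => hS ?_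
  have h1 : z.1 - vecMulVec z.2 (star z.2) = 0 := by
    refine (Matrix.PosSemidef.trace_eq_zero_iff hz.2).1 ?_
    rw [htr, h, sub_self, Complex.ofReal_zero]
  have h2 := hz.1
  rw [sub_eq_zero.1 h1] at h2
  exact eq_top_of_rank_one h2

/-- The Lovász number of a proper operator system is larger than one. -/
theorem one_lt_lovaszTheta {S : Submodule ℂ (Mat d)} (hS : (1 : Mat d) ∈ S) (hne : S ≠ ⊤) :
    1 < lovaszTheta S := by
  have hd : 0 < d := by
    rcases Nat.eq_zero_or_pos d with rfl | hd
    · exact absurd (Subsingleton.elim _ _) hne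
    · exact hd
  have hw : Continuous fun z : Matrix (Fin d × Fin d) (Fin d × Fin d) ℂ × (Fin d × Fin d → ℂ) =>
      weight (1 : Mat d) z.2 := continuous_weight continuous_const continuous_snd
  obtain ⟨z, hz, hmax⟩ := (isCompact_feasiblePairs S).exists_isMaxOn (feasiblePairs_nonempty hS)
    hw.continuousOn
  have hd' : (0 : ℝ) < d := Nat.cast_pos.2 hd
  -- The maximum with `d / 2` keeps the divisor positive and still below `d`.
  set c := max (weight (1 : Mat d) z.2) (d / 2) with hc
  have hc0 : 0 < c := lt_max_of_lt_right (by positivity)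
  have hcd : c < d := max_lt (weight_one_lt hne hz) (by linarith)
  have hT : (c⁻¹ • (1 : Mat d)) ∈ thCorner S := by
    rw [mem_thCorner_iff]
    refine ⟨PosSemidef.one.smul (inv_nonneg.2 hc0.le), fun y hy => ?_⟩
    rw [weight_real_smul, inv_mul_le_iff₀ hc0, mul_one]
    exact (hmax hy).trans (le_max_left _ _)
  refine lt_of_lt_of_le ?_ (trace_re_le_lovaszTheta hS hT)
  rw [trace_smul, trace_one, Complex.smul_re, smul_eq_mul, Fintype.card_fin, Complex.natCast_re,
    ← div_eq_inv_mul, one_lt_div hc0]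
  exact hcd

theorem hsOrthogonal_ne_top {L : Mat d} (hL : L ≠ 0) : hsOrthogonal {L} ≠ ⊤ := by
  intro h
  have h1 : L ∈ hsOrthogonal {L} := h ▸ Submodule.mem_top
  exact hL (trace_conjTranspose_mul_self_eq_zero_iff.1 (mem_hsOrthogonal_singleton.1 h1))

/-! #### A rank two complement -/

theorem star_dotProduct_mulVec_prod {ι : Type*} [Fintype ι]
    (X : Matrix (ι × Fin d) (ι × Fin d) ℂ) (b c : ι × Fin d → ℂ) :
    star b ⬝ᵥ (X *ᵥ c) = ∑ p, ∑ q, star (fun i => b (p, i)) ⬝ᵥ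
      (block X p q *ᵥ fun j => c (q, j)) := by
  simp only [dotProduct, mulVec, Fintype.sum_prod_type, Finset.mul_sum, Pi.star_apply, block_apply]
  refine Finset.sum_congr rfl fun p _ => ?_
  rw [Finset.sum_comm]

/-- The antisymmetric part of a positive block matrix is positive. -/
theorem re_sum_block_swap_le {ι : Type*} [Fintype ι] [DecidableEq ι]
    {X : Matrix (ι × Fin d) (ι × Fin d) ℂ} (hX : X.PosSemidef) (c : ι → Fin d → ℂ) :
    (∑ p, ∑ q, star (c p) ⬝ᵥ (block X q p *ᵥ c q)).re ≤
      (∑ p, ∑ q, star (c p) ⬝ᵥ (block X q q *ᵥ c p)).re := by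
  let e : ι → ι → ι × Fin d → ℂ := fun p q x => if x.1 = q then c p x.2 else 0
  have he : ∀ p q p' q', star (e p q) ⬝ᵥ (X *ᵥ e p' q') =
      star (c p) ⬝ᵥ (block X q q' *ᵥ c p') := by
    intro p q p' q'
    rw [star_dotProduct_mulVec_prod, Finset.sum_eq_single q, Finset.sum_eq_single q']
    · simp [e]
    · intro r _ hr
      have : (fun j => e p' q' (r, j)) = 0 := by funext j; simp [e, hr]
      rw [this, mulVec_zero, dotProduct_zero]
    · simp
    · intro r _ hr
      have : (fun j => e p q (r, j)) = 0 := by funext j; simp [e, hr]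
      rw [this, star_zero]
      simp
    · simp
  have h : ∀ p q, 0 ≤ (star (c p) ⬝ᵥ (block X q q *ᵥ c p)).re -
      (star (c p) ⬝ᵥ (block X q p *ᵥ c q)).re - (star (c q) ⬝ᵥ (block X p q *ᵥ c p)).re +
      (star (c q) ⬝ᵥ (block X p p *ᵥ c q)).re := by
    intro p q
    -- Antisymmetric test vectors; summing over `p` and `q` counts both sides of the claim twice.
    have h1 := (posSemidef_iff_re.1 hX).2 (e p q - e q p)
    rw [mulVec_sub, star_sub, sub_dotProduct, dotProduct_sub, dotProduct_sub, he, he, he, he] at h1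
    simp only [Complex.sub_re] at h1
    linarith
  have h2 := Finset.sum_nonneg fun p (_ : p ∈ Finset.univ) =>
    Finset.sum_nonneg fun q (_ : q ∈ Finset.univ) => h p q
  simp only [Finset.sum_add_distrib, Finset.sum_sub_distrib] at h2
  have h3 := Finset.sum_comm (s := Finset.univ) (t := Finset.univ)
    (f := fun p q => (star (c p) ⬝ᵥ (block X q p *ᵥ c q)).re)
  have h4 := Finset.sum_comm (s := Finset.univ) (t := Finset.univ)
    (f := fun p q => (star (c p) ⬝ᵥ (block X q q *ᵥ c p)).re)
  simp only [Complex.re_sum]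
  linarith

/-- The vector with entries `x`, `y` at `i`, `j` and zeros elsewhere. -/
def twoVec (i j : Fin d) (x y : ℂ) : Fin d → ℂ := Pi.single i x + Pi.single j y

theorem star_twoVec (i j : Fin d) (x y : ℂ) :
    star (twoVec i j x y) = twoVec i j (star x) (star y) := by
  simp [twoVec, Pi.star_single]

theorem twoVec_dotProduct (i j : Fin d) (x y : ℂ) (v : Fin d → ℂ) :
    twoVec i j x y ⬝ᵥ v = x * v i + y * v j := by
  simp [twoVec, add_dotProduct]

theorem star_twoVec_dotProduct_mulVec (A : Mat d) (i j : Fin d) (x y x' y' : ℂ) :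
    star (twoVec i j x y) ⬝ᵥ (A *ᵥ twoVec i j x' y') =
      star x * (A i i * x' + A i j * y') + star y * (A j i * x' + A j j * y') := by
  rw [star_twoVec, twoVec_dotProduct]
  have h : ∀ k, (A *ᵥ twoVec i j x' y') k = A k i * x' + A k j * y' := by
    intro k
    rw [mulVec, dotProduct_comm, twoVec_dotProduct]
    ring
  rw [h, h]

/-- Let `s` be the weight and `b` the restriction of `a` to the coordinates `i`, `j`. Domination
gives `s² ≤ ⟨b, X b⟩`. A `2 × 2` matrix with equal diagonal entries is fixed by reflection in the
antidiagonal, so swapping and conjugating the coordinates turns `⟨b, X b⟩` into the swapped sum of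
`re_sum_block_swap_le`. That is at most `s`, hence `s² ≤ s`. -/
theorem mem_thCorner_of_diag_eq {S : Submodule ℂ (Mat d)} {i j : Fin d} (hij : i ≠ j)
    (hS : ∀ A ∈ S, A i i = A j j) :
    (Matrix.single i i 1 + Matrix.single j j 1 : Mat d) ∈ thCorner S := by
  have hpos : ∀ k : Fin d, (Matrix.single k k 1 : Mat d).PosSemidef := fun k => by
    rw [← diagonal_single]
    refine PosSemidef.diagonal fun l => ?_
    rw [Pi.single_apply]
    split_ifs <;> simp
  have hquad : ∀ (k : Fin d) (v : Fin d → ℂ),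
      star v ⬝ᵥ ((Matrix.single k k 1 : Mat d) *ᵥ v) = star (v k) * v k := fun k v => by
    rw [← diagonal_single, dotProduct, Finset.sum_eq_single k]
    · rw [mulVec_diagonal]
      simp
    · intro l _ hl
      rw [mulVec_diagonal]
      simp [hl]
    · simp
  rw [mem_thCorner_iff]
  refine ⟨(hpos i).add (hpos j), ?_⟩
  rintro ⟨X, a⟩ ⟨hX, ha⟩
  dsimp only at hX ha ⊢
  let b : Fin d → Fin d → ℂ := fun p => twoVec i j (a (p, i)) (a (p, j))
  let c : Fin d → Fin d → ℂ := fun p => twoVec i j (star (a (p, j))) (star (a (p, i)))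
  let b' : Fin d × Fin d → ℂ := fun x => b x.1 x.2
  set s : ℝ := weight (Matrix.single i i 1 + Matrix.single j j 1 : Mat d) a with hs
  have hss : (s : ℂ) = ∑ p, (a (p, i) * star (a (p, i)) + a (p, j) * star (a (p, j))) := by
    rw [hs, weight, Complex.ofReal_sum]
    refine Finset.sum_congr rfl fun p _ => ?_
    have h1 : star (fun k => a (p, k)) ⬝ᵥ ((Matrix.single i i 1 + Matrix.single j j 1 : Mat d) *ᵥ
        fun k => a (p, k)) = ((‖a (p, i)‖ ^ 2 + ‖a (p, j)‖ ^ 2 : ℝ) : ℂ) := by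
      rw [add_mulVec, dotProduct_add, hquad, hquad, RCLike.star_def, Complex.conj_mul',
        Complex.conj_mul']
      push_cast
      rfl
    rw [h1, Complex.ofReal_re]
    simp only [RCLike.star_def, Complex.mul_conj']
    push_cast
    rfl
  have h1 : star a ⬝ᵥ b' = s := by
    rw [hss, dotProduct, Fintype.sum_prod_type]
    refine Finset.sum_congr rfl fun p _ => ?_
    have : ∑ k, (star a) (p, k) * b' (p, k) = twoVec i j (a (p, i)) (a (p, j)) ⬝ᵥ
        fun k => star (a (p, k)) := by
      rw [dotProduct_comm]; rfl
    rw [this, twoVec_dotProduct]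
  have h2 := (posSemidef_iff_re.1 ha).2 b'
  rw [sub_mulVec, dotProduct_sub, star_dotProduct_vecMulVec, h1, Complex.norm_real, Real.norm_eq_abs,
    sq_abs, Complex.sub_re, Complex.ofReal_re, star_dotProduct_mulVec_prod] at h2
  have h3 := re_sum_block_swap_le hX.posSemidef c
  have h4 : ∑ p, ∑ q, star (c p) ⬝ᵥ (block X q p *ᵥ c q) =
      ∑ p, ∑ q, star (fun k => b' (p, k)) ⬝ᵥ (block X p q *ᵥ fun k => b' (q, k)) := by
    rw [Finset.sum_comm]
    refine Finset.sum_congr rfl fun p _ => Finset.sum_congr rfl fun q _ => ?_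
    change star (c q) ⬝ᵥ (block X p q *ᵥ c p) = star (b p) ⬝ᵥ (block X p q *ᵥ b q)
    simp only [c, b, star_twoVec_dotProduct_mulVec, star_star, hS _ (hX.block_mem p q)]
    ring
  have h5 : ∑ p, ∑ q, star (c p) ⬝ᵥ (block X q q *ᵥ c p) = s := by
    rw [hss]
    refine Finset.sum_congr rfl fun p _ => ?_
    rw [← dotProduct_sum, ← sum_mulVec, hX.sum_block]
    simp only [c, star_twoVec_dotProduct_mulVec, star_star, one_apply_eq, one_apply_ne hij,
      one_apply_ne hij.symm]
    ring
  rw [h4, h5, Complex.ofReal_re] at h3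
  nlinarith

theorem two_le_lovaszTheta {S : Submodule ℂ (Mat d)} (hS1 : (1 : Mat d) ∈ S) {i j : Fin d}
    (hij : i ≠ j) (hS : ∀ A ∈ S, A i i = A j j) : 2 ≤ lovaszTheta S := by
  have h := trace_re_le_lovaszTheta hS1 (mem_thCorner_of_diag_eq hij hS)
  rw [trace_add, trace_single_eq_same, trace_single_eq_same, Complex.add_re, Complex.one_re] at h
  linarith

end Bounds

/-! ### A complement with a smaller Lovász number -/

section SmallTheta

variable {d : ℕ}

/-- The blocks of the test vector: a rotated first basis vector, zero, and basis vectors. -/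
noncomputable def testBlock (i j : Fin d) (x y : ℝ) (p : Fin d) : Fin d → ℂ :=
  if p = i then twoVec i j x y else if p = j then 0 else Pi.single p 1

theorem twoVec_apply (i j k : Fin d) (x y : ℂ) :
    twoVec i j x y k = (if k = i then x else 0) + if k = j then y else 0 := by
  simp [twoVec, Pi.single_apply]

theorem testBlock_apply {i j : Fin d} (x y : ℝ) (p k : Fin d) :
    testBlock i j x y p k = if p = i then twoVec i j x y k else
      if p = j then 0 else if k = p then 1 else 0 := by
  unfold testBlock
  split_ifs <;> simp_all

/-- Rotating `e_i`, `e_j` by an angle keeps an orthonormal basis; the test vector omits the second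
rotated vector, which is added back here. -/
theorem sum_testBlock {i j : Fin d} (hij : i ≠ j) {x y : ℝ} (hxy : x ^ 2 + y ^ 2 = 1)
    (k l : Fin d) :
    ∑ p, testBlock i j x y p k * star (testBlock i j x y p l) +
      twoVec i j y (-x) k * star (twoVec i j y (-x) l) = (1 : Mat d) k l := by
  have hxy' : (x : ℂ) * x + y * y = 1 := by
    rw [← sq, ← sq]
    exact_mod_cast hxy
  have h : ∀ p, testBlock i j x y p k * star (testBlock i j x y p l) =
      (if p = i then twoVec i j x y k * star (twoVec i j x y l) else 0) +
      (if p = k then if k = l ∧ k ≠ i ∧ k ≠ j then 1 else 0 else 0) := by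
    intro p
    simp only [testBlock_apply]
    by_cases h1 : p = i
    · subst h1
      by_cases h2 : p = k
      · subst h2; simp
      · simp [h2]
    · by_cases h2 : p = j
      · subst h2
        by_cases h3 : p = k
        · subst h3; simp [h1]
        · simp [h1, h3]
      · by_cases h3 : p = k
        · subst h3
          simp [h1, h2, eq_comm]
        · simp [h1, h2, h3, Ne.symm h3]
  simp only [h, Finset.sum_add_distrib, Finset.sum_ite_eq', Finset.mem_univ,
    if_true, twoVec_apply, one_apply]
  have hs : ∀ r : ℝ, star (r : ℂ) = r := Complex.conj_ofReal
  by_cases h1 : k = i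
  · subst h1
    by_cases h2 : l = k
    · subst h2
      simp [hij, hxy']
    · by_cases h3 : l = j
      · subst h3
        simp [hij, hij.symm]
        ring
      · simp [h2, h3, Ne.symm h2]
  · by_cases h2 : k = j
    · subst h2
      by_cases h3 : l = k
      · subst h3
        simp [h1]
        rw [add_comm, hxy']
      · by_cases h4 : l = i
        · subst h4
          simp [h1, Ne.symm h1]
          ring
        · simp [h3, h4, Ne.symm h3]
    · simp [h1, h2]

theorem weight_testBlock (T : Mat d) {i j : Fin d} (hij : i ≠ j) (x y : ℝ) :
    weight T (fun z : Fin d × Fin d => testBlock i j x y z.1 z.2) =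
      x * (x * (T i i).re + y * (T i j).re) + y * (x * (T j i).re + y * (T j j).re) +
        ((T.trace).re - (T i i).re - (T j j).re) := by
  have h : ∀ p, (star (testBlock i j x y p) ⬝ᵥ (T *ᵥ testBlock i j x y p)).re = (T p p).re +
      (if p = i then x * (x * (T i i).re + y * (T i j).re) +
        y * (x * (T j i).re + y * (T j j).re) - (T i i).re else 0) +
      (if p = j then - (T j j).re else 0) := by
    intro p
    unfold testBlock
    by_cases h1 : p = i
    · subst h1
      rw [if_pos rfl, if_pos rfl, if_neg hij, star_twoVec_dotProduct_mulVec]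
      simp
      ring
    · by_cases h2 : p = j
      · subst h2
        simp [h1]
      · simp [h1, h2, Pi.star_single]
  rw [weight]
  refine (Finset.sum_congr rfl fun p _ => h p).trans ?_
  simp only [Finset.sum_add_distrib, Finset.sum_ite_eq', Finset.mem_univ, if_true, trace, diag_apply,
    Complex.re_sum]
  ring

/-- Take `X = a a* + b b*`, with the omitted rotated vector placed in block `k`. The only blocks
with nonzero diagonal entries at `i`, `j`, `k` are `(i, i)`, with `(1/3, 2/3, 0)`, and `(k, k)`,
with `(2/3, 1/3, 1)`. Both satisfy the linear condition, which dictates the values of `x²` and `y²`.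
-/
theorem weight_testBlock_le {S : Submodule ℂ (Mat d)} {i j k : Fin d} (hij : i ≠ j) (hik : i ≠ k)
    (hjk : j ≠ k) (hS : ∀ A : Mat d, 2 * A i i = A j j + A k k → A ∈ S) {T : Mat d}
    (hT : T ∈ thCorner S) {x y : ℝ} (hx : x ^ 2 = 1 / 3) (hy : y ^ 2 = 2 / 3) :
    weight T (fun z : Fin d × Fin d => testBlock i j x y z.1 z.2) ≤ 1 := by
  let a : Fin d × Fin d → ℂ := fun z => testBlock i j x y z.1 z.2
  let b : Fin d × Fin d → ℂ := fun z => if z.1 = k then twoVec i j y (-x) z.2 else 0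
  have hblock : ∀ p q r s, block (vecMulVec a (star a) + vecMulVec b (star b)) p q r s =
      testBlock i j x y p r * star (testBlock i j x y q s) +
        if p = k ∧ q = k then twoVec i j y (-x) r * star (twoVec i j y (-x) s) else 0 := by
    intro p q r s
    simp only [block_apply, Matrix.add_apply, vecMulVec_apply, Pi.star_apply, a, b]
    by_cases hp : p = k <;> by_cases hq : q = k <;> simp [hp, hq]
  have hx' : (x : ℂ) * x = 1 / 3 := by
    rw [← sq, ← Complex.ofReal_pow, hx]; norm_num
  have hy' : (y : ℂ) * y = 2 / 3 := by
    rw [← sq, ← Complex.ofReal_pow, hy]; norm_num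
  refine (mem_thCorner_iff.1 hT).2 (vecMulVec a (star a) + vecMulVec b (star b), a)
    ⟨⟨(posSemidef_vecMulVec_self_star a).add (posSemidef_vecMulVec_self_star b),
      fun p q => hS _ ?_, ?_⟩, ?_⟩
  · simp only [hblock, testBlock_apply, twoVec_apply]
    by_cases hp : p = i
    · subst hp
      by_cases hq : q = p
      · subst hq
        simp [hij, hij.symm, hik, hik.symm, hjk.symm, hx', hy']
        norm_num
      · by_cases hq2 : q = j
        · subst hq2; simp [hij, hij.symm, hik, hik.symm, hjk.symm]
        · by_cases hq3 : q = k
          · subst hq3; simp [hij, hik, hik.symm, hjk, hjk.symm]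
          · simp [hik, hq, hq2, Ne.symm hq, Ne.symm hq2, hik.symm, hjk.symm]
    · by_cases hp2 : p = j
      · subst hp2; simp [hij.symm, hjk]
      · by_cases hp3 : p = k
        · subst hp3
          by_cases hq : q = p
          · subst hq
            simp [hp, hp2, hij, hij.symm, hik, hjk, hx', hy']
            norm_num
          · simp [hp, hp2, hq, hik, hjk, Ne.symm hq]
        · simp [hp, hp2, hp3, Ne.symm hp, Ne.symm hp2, Ne.symm hp3]
  · ext r s
    rw [Matrix.sum_apply, ← sum_testBlock hij (x := x) (y := y) (by rw [hx, hy]; norm_num) r s]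
    simp only [hblock, and_self, Finset.sum_add_distrib, Finset.sum_ite_eq', Finset.mem_univ,
      if_true]
  · rw [IsDominated, add_sub_cancel_left]
    exact posSemidef_vecMulVec_self_star b

theorem lovaszTheta_le_nine_fifths {S : Submodule ℂ (Mat d)} (hS1 : (1 : Mat d) ∈ S)
    {i j k : Fin d} (hij : i ≠ j) (hik : i ≠ k) (hjk : j ≠ k)
    (hS : ∀ A : Mat d, 2 * A i i = A j j + A k k → A ∈ S) : lovaszTheta S ≤ 9 / 5 := by
  refine lovaszTheta_le fun T hT => ?_
  have hx : (Real.sqrt (1 / 3)) ^ 2 = 1 / 3 := Real.sq_sqrt (by norm_num)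
  have hy : (Real.sqrt (2 / 3)) ^ 2 = 2 / 3 := Real.sq_sqrt (by norm_num)
  have hy2 : (-Real.sqrt (2 / 3)) ^ 2 = 2 / 3 := by rw [neg_sq, hy]
  have hS' : ∀ A : Mat d, 2 * A i i = A k k + A j j → A ∈ S := fun A hA =>
    hS A (by rw [hA, add_comm])
  -- Averaging over the sign of `y` removes off-diagonal entries and leaves `Tr T - (2/3) T_ii -
  -- (1/3) T_jj ≤ 1`. Adding the same bound with `k` for `j`, and using `T_jj + T_kk ≤ Tr T - T_ii`
  -- and `T_ii ≤ 1`, gives `(5/3) Tr T ≤ 3`.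
  have h1 := weight_testBlock_le hij hik hjk hS hT hx hy
  have h2 := weight_testBlock_le hij hik hjk hS hT hx hy2
  have h3 := weight_testBlock_le hik hij hjk.symm hS' hT hx hy
  have h4 := weight_testBlock_le hik hij hjk.symm hS' hT hx hy2
  rw [weight_testBlock T hij] at h1 h2
  rw [weight_testBlock T hik] at h3 h4
  have h5 : (T i i).re ≤ 1 := by
    have := (Complex.le_def.1 (Matrix.PosSemidef.diag_nonneg
      (one_sub_posSemidef_of_mem_thCorner hS1 hT) (i := i))).1
    rw [Matrix.sub_apply, one_apply_eq, Complex.sub_re, Complex.one_re, Complex.zero_re] at this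
    linarith
  have hdiag : ∀ l, 0 ≤ (T l l).re := fun l =>
    (Complex.le_def.1 (Matrix.PosSemidef.diag_nonneg hT.1 (i := l))).1
  have h6 : (T i i).re + (T j j).re + (T k k).re ≤ T.trace.re := by
    have h7 := Finset.sum_le_sum_of_subset_of_nonneg (Finset.subset_univ {i, j, k})
      (f := fun l => (T l l).re) fun l _ _ => hdiag l
    rw [Finset.sum_insert (by simp [hij, hik]), Finset.sum_pair hjk] at h7
    rw [trace, Complex.re_sum]
    simp only [diag_apply]
    linarith
  nlinarith

end SmallTheta

/-- On the complement of `diag(1, -1, 0, …)` the Lovász number is at least two, on that of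
`diag(2, -1, -1, 0, …)` it is at most `9 / 5`. -/
theorem exists_lovaszTheta_lt {d : ℕ} (hd : 3 ≤ d) : ∃ L ∈ tracelessHermitian d,
    ∃ M ∈ tracelessHermitian d, lovaszTheta (hsOrthogonal {L}) < lovaszTheta (hsOrthogonal {M}) := by
  let i : Fin d := ⟨0, by omega⟩
  let j : Fin d := ⟨1, by omega⟩
  let k : Fin d := ⟨2, by omega⟩
  have hij : i ≠ j := by simp [i, j]
  have hik : i ≠ k := by simp [i, k]
  have hjk : j ≠ k := by simp [j, k]
  have htr : ∀ (l : Fin d) (A : Mat d), (Matrix.single l l 1 * A).trace = A l l := by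
    intro l A
    rw [trace_mul_comm, trace_mul_single]
    simp
  let L : Mat d := (Matrix.single i i 1 - Matrix.single j j 1) +
    (Matrix.single i i 1 - Matrix.single k k 1)
  have hL : L ∈ tracelessHermitian d := by
    have h1 := single_sub_single_mem hij
    have h2 := single_sub_single_mem hik
    refine ⟨h1.1.add h2.1, by rw [trace_add, h1.2.1, h2.2.1, add_zero], fun h => ?_⟩
    have := congrArg (fun M : Mat d => M j j) h
    simp [L, hij, hjk.symm] at this
  have hM := single_sub_single_mem hij
  refine ⟨L, hL, _, hM, ?_⟩
  have h1 : lovaszTheta (hsOrthogonal {L}) ≤ 9 / 5 := by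
    refine lovaszTheta_le_nine_fifths (isOperatorSystem_hsOrthogonal hL).1 hij hik hjk fun A hA => ?_
    rw [mem_hsOrthogonal_singleton, hL.1.eq]
    simp only [L, Matrix.add_mul, Matrix.sub_mul, trace_add, trace_sub, htr]
    linear_combination hA
  have h2 := two_le_lovaszTheta (isOperatorSystem_hsOrthogonal hM).1 hij fun A hA => by
    rw [mem_hsOrthogonal_singleton, hM.1.eq, Matrix.sub_mul, trace_sub, htr, htr] at hA
    exact sub_eq_zero.1 hA
  linarith

theorem exists_image_lovaszTheta_eq_Icc {d : ℕ} (hd : 2 ≤ d) :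
    ∃ δ₁ δ₂ : ℝ, 1 < δ₁ ∧ δ₁ ≤ δ₂ ∧ (3 ≤ d → δ₁ < δ₂) ∧ δ₂ ≤ d ∧
      (fun L : Mat d => lovaszTheta (hsOrthogonal {L})) '' tracelessHermitian d =
        Set.Icc δ₁ δ₂ := by
  have himg := image_lovaszTheta_hsOrthogonal_eq_Icc hd
  generalize sInf ((fun L : Mat d => lovaszTheta (hsOrthogonal {L})) '' tracelessHermitian d) = δ₁
    at himg
  generalize sSup ((fun L : Mat d => lovaszTheta (hsOrthogonal {L})) '' tracelessHermitian d) = δ₂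
    at himg
  have hne : (Set.Icc δ₁ δ₂).Nonempty := by
    rw [← himg]
    exact (isConnected_tracelessHermitian hd).nonempty.image _
  have h12 := Set.nonempty_Icc.1 hne
  obtain ⟨L, hL, hL1⟩ := himg.symm.subset (Set.left_mem_Icc.2 h12)
  obtain ⟨M, hM, hM2⟩ := himg.symm.subset (Set.right_mem_Icc.2 h12)
  refine ⟨δ₁, δ₂, ?_, h12, fun hd3 => ?_, ?_, himg⟩
  · rw [← hL1]
    exact one_lt_lovaszTheta (isOperatorSystem_hsOrthogonal hL).1 (hsOrthogonal_ne_top hL.2.2)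
  · obtain ⟨A, hA, B, hB, hAB⟩ := exists_lovaszTheta_lt hd3
    have hA' := himg.subset ⟨A, hA, rfl⟩
    have hB' := himg.subset ⟨B, hB, rfl⟩
    exact hA'.1.trans_lt (hAB.trans_le hB'.2)
  · rw [← hM2]
    exact lovaszTheta_le fun T hT =>
      trace_re_le_of_mem_thCorner (isOperatorSystem_hsOrthogonal hM).1 hT

end NCGraph

theorem mainTheorem10 (d : ℕ) :
    -- the output dimension may be bounded by `d²`
    (∀ S : Submodule ℂ (Mat d), IsOperatorSystem S →
      (∀ k : ℕ, d ^ 2 ≤ k →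
        thCornerAt S (d ^ 2) = thCornerAt S k ∧
        thCornerAt S k =
          {T | T.PosSemidef ∧ ∀ Ψ ∈ channelsInto S k ∩ extremeChannels d k,
            (1 - Ψ T).PosSemidef}) ∧
      thCorner S = thCornerAt S (d ^ 2) ∧
      lovaszTheta S = lovaszThetaAt S (d ^ 2)) ∧
    -- continuity of `S ↦ th(S)` and `S ↦ θ(S)`
    (∀ (S : Submodule ℂ (Mat d)) (Sn : ℕ → Submodule ℂ (Mat d)),
      IsOperatorSystem S → (∀ n, IsOperatorSystem (Sn n)) →
      KuratowskiTendsto (fun n => (Sn n : Set (Mat d))) (S : Set (Mat d)) →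
      KuratowskiTendsto (fun n => thCorner (Sn n)) (thCorner S) ∧
      Tendsto (fun n => lovaszTheta (Sn n)) atTop (𝓝 (lovaszTheta S))) ∧
    -- the function `Λ ↦ θ({Λ}^⊥)`
    ContinuousOn (fun Λ : Mat d => lovaszTheta (hsOrthogonal {Λ})) (tracelessHermitian d) ∧
    (2 ≤ d → ∃ δ₁ δ₂ : ℝ, 1 < δ₁ ∧ δ₁ ≤ δ₂ ∧ (3 ≤ d → δ₁ < δ₂) ∧ δ₂ ≤ d ∧
      (fun Λ : Mat d => lovaszTheta (hsOrthogonal {Λ})) '' tracelessHermitian d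
        = Set.Icc δ₁ δ₂) := by
  refine ⟨fun S hS => ⟨fun k hk => ⟨?_, thCornerAt_eq_extremeChannels S k⟩, ?_, ?_⟩,
    fun S Sn hS hSn h => ⟨kuratowskiTendsto_thCorner hSn h, tendsto_lovaszTheta hS hSn h⟩,
    continuousOn_lovaszTheta_hsOrthogonal, exists_image_lovaszTheta_eq_Icc⟩
  · rw [thCornerAt_eq_weightPolar S le_rfl, thCornerAt_eq_weightPolar S hk]
  · rw [thCorner_eq_weightPolar, thCornerAt_eq_weightPolar S le_rfl]
  · rw [lovaszTheta, lovaszThetaAt, thCorner_eq_weightPolar, thCornerAt_eq_weightPolar S le_rfl]
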